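/- **Setting.** Let $\tau_{con},\tau_{com}\ge 0$, $\tau=\tau_{con}+\tau_{com}$. Consider $N$ followers $$\dot x_i(t)=\bar A_ix_i(t)+\bar B_iu_i(t-\tau_{con})+\bar E_iv(t),\qquad y_i(t)=\bar C_ix_i(t),\qquad t\ge 0,\ i=1,\dots,N,$$ with $x_i\in\mathbb R^n$, $u_i\in\mathbb R^m$, $y_i\in\mathbb R^p$, driven by the exosystem (leader, node $0$) $\dot v=Sv$, $v\in\mathbb R^q$, with $y_0=-Fv$ and regulated outputs $e_i=y_i-y_0$. Here $(\bar A_i,\bar B_i,\bar E_i,\bar C_i)=(A_i,B_i,E_i,C_i)+(\delta_iA,\delta_iB,\delta_iE,\delta_iC)$, and $w$ denotes the collection of all the perturbations; $w=0$ is the nominal plant. Let $\bar{\mathcal G}$ be a digraph without self-loops on $\{0,\dots,N\}$ with no edge into $0$, with weights $a_{ij}\ge 0$ such that $a_{ij}>0$ iff $(j,i)$ is an edge; let $\Delta=\mathrm{diag}(a_{10},\dots,a_{N0})$ and let $H$ be the block of the weighted Laplacian indexed by the followers. The virtual regulated outputs are $e_{vi}=\sum_{j=0}^N a_{ij}(y_i-y_j)$.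 With $x,u,e_v$ the stacked vectors, $\tilde A=\mathrm{blockdiag}(\bar A_i)$, $\tilde B=\mathrm{blockdiag}(\bar B_i)$, $\tilde E=\mathrm{col}(\bar E_i)$, $\tilde C=(H\otimes I_p)\,\mathrm{blockdiag}(\bar C_i)$, $\tilde F=(\Delta\mathbf 1_N)\otimes F$, the *auxiliary system* is $$\dot x(t)=\tilde Ax(t)+\tilde Bu(t-\tau_{con})+\tilde Ev(t),\quad \dot v=Sv,\quad e_v=\tilde Cx+\tilde Fv,\qquad t\ge 0 .$$ Let $(G_1,G_2)$ be a minimal $p$-copy internal model of $S$: $G_1=\mathrm{blockdiag}(\beta,\dots,\beta)$, $G_2=\mathrm{blockdiag}(\sigma,\dots,\sigma)$ ($p$ blocks each), where $\beta$ is a square matrix whose characteristic polynomial is the minimal polynomial of $S$ and $\sigma$ is a column vector with $(\beta,\sigma)$ controllable. Put $\tilde G_k=I_N\otimes G_k$. The *augmented system* is the auxiliary system together with $$\dot z(t)=\tilde G_1z(t)+\tilde G_2e_v(t-\tau_{com}),\qquad t\ge 0 .$$ All closed-loop states have arbitrary continuous initial functions on $[-\tau,0]$, and exponential stability is with respect to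 the supremum norm of the initial function. A feedback *stabilizes the nominal augmented system* if the resulting closed loop with $w=0$ and $v=0$ is exponentially stable. A control law *solves the robust output regulation problem of the auxiliary system* if (1) the closed loop with $w=0$, $v=0$ is exponentially stable, and (2) there is an open neighbourhood $W$ of $w=0$ such that for all $w\in W$ and all initial conditions $e_v(t)\to 0$ as $t\to\infty$. It *solves the cooperative robust output regulation problem* of the plant if (1) and (2) hold for the closed loop of the plant with this control law, with "$e_i(t)\to 0$ for $i=1,\dots,N$" in place of "$e_v(t)\to0$". (The gains below are arbitrary; the law is distributed only if they respect the graph.) **Lemma.** Assume that all the eigenvalues of $S$ lie on the imaginary axis. (i) If the static state feedback $u(t)=\tilde K_xx(t-\tau_{com})+\tilde K_zz(t)$ stabilizes the nominal augmented system, then the dynamic state feedback law $$u(t)=\tilde K_xx(t-\tau_{com})+\tilde K_zz(t),\qquad \dot z(t)=\tilde G_1z(t)+\tilde G_2e_v(t-\tau_{com})$$ solves the robust output regulation problem of the auxiliary system. (ii) If, with $\zeta=\mathrm{col}(z,\xi)$, the dynamic output feedback $$u(t)=\tilde K_1z(t)+\tilde K_2\xi(t),\qquad \dot\xi(t)=\tilde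 S_1\xi(t)+\tilde S_2e_v(t-\tau_{com})+\tilde S_3\zeta(t-\tau)$$ stabilizes the nominal augmented system, then the dynamic output feedback law consisting of these equations and $\dot z(t)=\tilde G_1z(t)+\tilde G_2e_v(t-\tau_{com})$ solves the robust output regulation problem of the auxiliary system. If, moreover, $\bar{\mathcal G}$ contains a directed spanning tree with root $0$, then in either case the same control law also solves the cooperative robust output regulation problem of the plant. -/

import Mathlib

open Set Filter Topology
open scoped Matrix Kronecker

/-- The matrices `(A_i, B_i, E_i, C_i)`, `i = 1, …, N`, of the follower subsystems.  This real vector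
space is used both for plants and for perturbations `w` of a plant, with its usual topology. -/
abbrev PlantMatrices (N n m p q : ℕ) : Type :=
  (Fin N → Matrix (Fin n) (Fin n) ℝ) × (Fin N → Matrix (Fin n) (Fin m) ℝ) ×
    (Fin N → Matrix (Fin n) (Fin q) ℝ) × (Fin N → Matrix (Fin p) (Fin n) ℝ)

namespace PlantMatrices

variable {N n m p q : ℕ}

def A (P : PlantMatrices N n m p q) : Fin N → Matrix (Fin n) (Fin n) ℝ := P.1

def B (P : PlantMatrices N n m p q) : Fin N → Matrix (Fin n) (Fin m) ℝ := P.2.1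

def E (P : PlantMatrices N n m p q) : Fin N → Matrix (Fin n) (Fin q) ℝ := P.2.2.1

def C (P : PlantMatrices N n m p q) : Fin N → Matrix (Fin p) (Fin n) ℝ := P.2.2.2

end PlantMatrices

/-- The data of a leader-follower network.  Node `0` is the leader, node `i.succ` is the follower
`i : Fin N`. -/
structure LeaderFollowerNetwork (N n m p q : ℕ) where
  /-- the communication delay -/
  τcom : ℝ
  /-- the input delay -/
  τcon : ℝ
  τcom_nonneg : 0 ≤ τcom
  τcon_nonneg : 0 ≤ τcon
  /-- the communication digraph: `graph.Adj j i` means that `(j, i)` is an edge, i.e. `j` is a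
  neighbour of `i` -/
  graph : Digraph (Fin (N + 1))
  graph_irrefl : ∀ i, ¬ graph.Adj i i
  /-- the leader receives no information -/
  graph_leader : ∀ j, ¬ graph.Adj j 0
  /-- the weighted adjacency matrix `[a_ij]` -/
  weight : Matrix (Fin (N + 1)) (Fin (N + 1)) ℝ
  weight_nonneg : ∀ i j, 0 ≤ weight i j
  weight_pos_iff : ∀ i j, 0 < weight i j ↔ graph.Adj j i
  /-- the exosystem matrix -/
  S : Matrix (Fin q) (Fin q) ℝ
  /-- the leader output is `y₀ = -F v` -/
  F : Matrix (Fin p) (Fin q) ℝ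
  /-- the nominal plant -/
  nominal : PlantMatrices N n m p q

/-- All the (complex) eigenvalues of `S` lie on the imaginary axis. -/
def EigenvaluesOnImaginaryAxis {q : ℕ} (S : Matrix (Fin q) (Fin q) ℝ) : Prop :=
  ∀ μ ∈ spectrum ℂ (S.map (algebraMap ℝ ℂ)), μ.re = 0

/-- `G` contains a directed spanning tree `T` with root `r`: every node other than `r` has exactly
one parent in `T`, `r` has none, and `T` has a directed path from `r` to every node. -/
def HasDirectedSpanningTree {V : Type*} (G : Digraph V) (r : V) : Prop :=
  ∃ T : Digraph V, T ≤ G ∧ (∀ j, ¬ T.Adj j r) ∧ (∀ i, i ≠ r → ∃! j, T.Adj j i) ∧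
    ∀ i, Relation.ReflTransGen T.Adj r i

/-- The single-input pair `(β, σ)` is controllable: `[σ, βσ, …, β^{d-1}σ]` has rank `d`. -/
def IsControllablePair {d : ℕ} (β : Matrix (Fin d) (Fin d) ℝ) (σ : Fin d → ℝ) : Prop :=
  (Matrix.of fun i k : Fin d => ((β ^ (k : ℕ)) *ᵥ σ) i).rank = d

/-- `(G₁, G₂)` is the minimal `p`-copy internal model of `S`: `G₁ = block diag (β, …, β)` and
`G₂ = block diag (σ, …, σ)` with `p` blocks each. -/
def IsMinimalInternalModel {p q d : ℕ} (S : Matrix (Fin q) (Fin q) ℝ)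
    (G₁ : Matrix (Fin p × Fin d) (Fin p × Fin d) ℝ) (G₂ : Matrix (Fin p × Fin d) (Fin p) ℝ) :
    Prop :=
  ∃ (β : Matrix (Fin d) (Fin d) ℝ) (σ : Fin d → ℝ),
    β.charpoly = minpoly ℝ S ∧ IsControllablePair β σ ∧
    G₁ = (1 : Matrix (Fin p) (Fin p) ℝ) ⊗ₖ β ∧
    G₂ = Matrix.of fun k l => if k.1 = l then σ k.2 else 0

/-- The block diagonal matrix with blocks `M 0, …, M (N-1)`, acting on stacked vectors. -/
def stackDiag {N k l : ℕ} (M : Fin N → Matrix (Fin k) (Fin l) ℝ) :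
    Matrix (Fin N × Fin k) (Fin N × Fin l) ℝ :=
  (Matrix.blockDiagonal M).submatrix Prod.swap Prod.swap

/-- The `i`-th component of a stacked vector `col (f_1, …, f_N)`. -/
def agent {N k : ℕ} (f : Fin N × Fin k → ℝ) (i : Fin N) : Fin k → ℝ := fun j => f (i, j)

/-- Exponential stability of the zero solution, uniformly over a given set of solutions on
`[-r, ∞)`, with respect to the supremum norm of the initial function on `[-r, 0]`. -/
def ExponentiallyStable {E : Type*} [NormedAddCommGroup E] (r : ℝ) (sol : Set (ℝ → E)) : Prop :=
  ∃ κ α : ℝ, 0 < α ∧ ∀ X ∈ sol, ∀ b : ℝ, (∀ θ ∈ Icc (-r) 0, ‖X θ‖ ≤ b) →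
    ∀ t, 0 ≤ t → ‖X t‖ ≤ κ * Real.exp (-α * t) * b

/-- A control law, as the relation that it imposes on the plant state `x`, the virtual regulated
output `e_v`, the controller state `c` and the input `u` (as functions of time). -/
abbrev ControlLaw (N n m p : ℕ) (E : Type) : Type :=
  (ℝ → Fin N × Fin n → ℝ) → (ℝ → Fin N × Fin p → ℝ) → (ℝ → E) → (ℝ → Fin N × Fin m → ℝ) → Prop

namespace LeaderFollowerNetwork

variable {N n m p q d r : ℕ}

/-- The total delay. -/
def τ (M : LeaderFollowerNetwork N n m p q) : ℝ := M.τcom + M.τcon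

/-- The Laplacian of the weighted digraph. -/
def laplacian (M : LeaderFollowerNetwork N n m p q) : Matrix (Fin (N + 1)) (Fin (N + 1)) ℝ :=
  Matrix.diagonal (fun i => ∑ j, M.weight i j) - M.weight

/-- The follower block of the Laplacian. -/
def H (M : LeaderFollowerNetwork N n m p q) : Matrix (Fin N) (Fin N) ℝ :=
  M.laplacian.submatrix Fin.succ Fin.succ

/-! ### The auxiliary system -/

def tildeE (P : PlantMatrices N n m p q) : Matrix (Fin N × Fin n) (Fin q) ℝ :=
  Matrix.of fun k l => P.E k.1 k.2 l

def tildeC (M : LeaderFollowerNetwork N n m p q) (P : PlantMatrices N n m p q) :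
    Matrix (Fin N × Fin p) (Fin N × Fin n) ℝ :=
  (M.H ⊗ₖ (1 : Matrix (Fin p) (Fin p) ℝ)) * stackDiag P.C

/-- `(Δ 1_N) ⊗ F`, where `Δ = diag (a_10, …, a_N0)`. -/
def tildeF (M : LeaderFollowerNetwork N n m p q) : Matrix (Fin N × Fin p) (Fin q) ℝ :=
  Matrix.of fun k l => M.weight k.1.succ 0 * M.F k.2 l

/-- The output `e_v = C̃ x + F̃ v` of the auxiliary system with plant matrices `P`. -/
def auxOutput (M : LeaderFollowerNetwork N n m p q) (P : PlantMatrices N n m p q)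
    (x : ℝ → Fin N × Fin n → ℝ) (v : ℝ → Fin q → ℝ) (t : ℝ) : Fin N × Fin p → ℝ :=
  M.tildeC P *ᵥ x t + M.tildeF *ᵥ v t

/-- `v` solves the exosystem `v' = S v` for `t ≥ 0` (it may have any continuous past). -/
def IsExosystemTrajectory (M : LeaderFollowerNetwork N n m p q) (v : ℝ → Fin q → ℝ) : Prop :=
  ContinuousOn v (Ici (-M.τ)) ∧ ∀ t, 0 ≤ t → HasDerivWithinAt v (M.S *ᵥ v t) (Ici 0) t

/-- `x` solves `x' = Ã x + B̃ u(t - τcon) + Ẽ v` for `t ≥ 0`, with a continuous initial function. -/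
def IsAuxTrajectory (M : LeaderFollowerNetwork N n m p q) (P : PlantMatrices N n m p q)
    (x : ℝ → Fin N × Fin n → ℝ) (u : ℝ → Fin N × Fin m → ℝ) (v : ℝ → Fin q → ℝ) : Prop :=
  ContinuousOn x (Ici (-M.τ)) ∧
    ∀ t, 0 ≤ t → HasDerivWithinAt x
      (stackDiag P.A *ᵥ x t + stackDiag P.B *ᵥ u (t - M.τcon) + tildeE P *ᵥ v t) (Ici 0) t

/-- `z` solves `z' = G̃₁ z + G̃₂ e_v(t - τcom)` for `t ≥ 0`, where `G̃ᵢ = I_N ⊗ Gᵢ`, with a continuous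
initial function. -/
def IsInternalModelTrajectory (M : LeaderFollowerNetwork N n m p q)
    (G₁ : Matrix (Fin p × Fin d) (Fin p × Fin d) ℝ) (G₂ : Matrix (Fin p × Fin d) (Fin p) ℝ)
    (ev : ℝ → Fin N × Fin p → ℝ) (z : ℝ → Fin N × Fin p × Fin d → ℝ) : Prop :=
  ContinuousOn z (Ici (-M.τ)) ∧
    ∀ t, 0 ≤ t → HasDerivWithinAt z
      (((1 : Matrix (Fin N) (Fin N) ℝ) ⊗ₖ G₁) *ᵥ z t +
        ((1 : Matrix (Fin N) (Fin N) ℝ) ⊗ₖ G₂) *ᵥ ev (t - M.τcom)) (Ici 0) t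

/-- The augmented system: the auxiliary system together with the internal model. -/
def IsAugmentedTrajectory (M : LeaderFollowerNetwork N n m p q)
    (G₁ : Matrix (Fin p × Fin d) (Fin p × Fin d) ℝ) (G₂ : Matrix (Fin p × Fin d) (Fin p) ℝ)
    (P : PlantMatrices N n m p q) (x : ℝ → Fin N × Fin n → ℝ)
    (z : ℝ → Fin N × Fin p × Fin d → ℝ) (u : ℝ → Fin N × Fin m → ℝ) (v : ℝ → Fin q → ℝ) : Prop :=
  M.IsExosystemTrajectory v ∧ M.IsAuxTrajectory P x u v ∧
    M.IsInternalModelTrajectory G₁ G₂ (M.auxOutput P x v) z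

/-! ### Feedback laws -/

/-- `u(t) = K̃x x(t - τcom) + K̃z z(t)`. -/
def StaticStateFeedback (M : LeaderFollowerNetwork N n m p q)
    (Kx : Matrix (Fin N × Fin m) (Fin N × Fin n) ℝ)
    (Kz : Matrix (Fin N × Fin m) (Fin N × Fin p × Fin d) ℝ)
    (x : ℝ → Fin N × Fin n → ℝ) (z : ℝ → Fin N × Fin p × Fin d → ℝ)
    (u : ℝ → Fin N × Fin m → ℝ) : Prop :=
  ∀ t, -M.τcon ≤ t → u t = Kx *ᵥ x (t - M.τcom) + Kz *ᵥ z t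

/-- `u(t) = K̃₁ z(t) + K̃₂ ξ(t)`, `ξ' = S̃₁ ξ + S̃₂ e_v(t - τcom) + S̃₃ ζ(t - τ)` with
`ζ = col (z, ξ)`, where `ξ = col (ξ_1, …, ξ_N)` and `ξ_i ∈ ℝ^r`. -/
def DynamicOutputFeedback (M : LeaderFollowerNetwork N n m p q)
    (K₁ : Matrix (Fin N × Fin m) (Fin N × Fin p × Fin d) ℝ)
    (K₂ : Matrix (Fin N × Fin m) (Fin N × Fin r) ℝ)
    (S₁ : Matrix (Fin N × Fin r) (Fin N × Fin r) ℝ)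
    (S₂ : Matrix (Fin N × Fin r) (Fin N × Fin p) ℝ)
    (S₃ : Matrix (Fin N × Fin r) ((Fin N × Fin p × Fin d) ⊕ (Fin N × Fin r)) ℝ)
    (ev : ℝ → Fin N × Fin p → ℝ) (z : ℝ → Fin N × Fin p × Fin d → ℝ)
    (ξ : ℝ → Fin N × Fin r → ℝ) (u : ℝ → Fin N × Fin m → ℝ) : Prop :=
  (∀ t, -M.τcon ≤ t → u t = K₁ *ᵥ z t + K₂ *ᵥ ξ t) ∧
    ContinuousOn ξ (Ici (-M.τ)) ∧
    ∀ t, 0 ≤ t → HasDerivWithinAt ξ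
      (S₁ *ᵥ ξ t + S₂ *ᵥ ev (t - M.τcom) + S₃ *ᵥ Sum.elim (z (t - M.τ)) (ξ (t - M.τ))) (Ici 0) t

/-- The static state feedback stabilizes the nominal augmented system (with `v = 0`). -/
def StaticStabilizesNominalAugmented (M : LeaderFollowerNetwork N n m p q)
    (G₁ : Matrix (Fin p × Fin d) (Fin p × Fin d) ℝ) (G₂ : Matrix (Fin p × Fin d) (Fin p) ℝ)
    (Kx : Matrix (Fin N × Fin m) (Fin N × Fin n) ℝ)
    (Kz : Matrix (Fin N × Fin m) (Fin N × Fin p × Fin d) ℝ) : Prop :=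
  ExponentiallyStable M.τ
    {X : ℝ → (Fin N × Fin n → ℝ) × (Fin N × Fin p × Fin d → ℝ) |
      ∃ x z u, (∀ t, X t = (x t, z t)) ∧
        M.IsAugmentedTrajectory G₁ G₂ M.nominal x z u (fun _ => 0) ∧
        M.StaticStateFeedback Kx Kz x z u}

/-- The dynamic output feedback stabilizes the nominal augmented system (with `v = 0`). -/
def DynamicStabilizesNominalAugmented (M : LeaderFollowerNetwork N n m p q)
    (G₁ : Matrix (Fin p × Fin d) (Fin p × Fin d) ℝ) (G₂ : Matrix (Fin p × Fin d) (Fin p) ℝ)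
    (K₁ : Matrix (Fin N × Fin m) (Fin N × Fin p × Fin d) ℝ)
    (K₂ : Matrix (Fin N × Fin m) (Fin N × Fin r) ℝ)
    (S₁ : Matrix (Fin N × Fin r) (Fin N × Fin r) ℝ)
    (S₂ : Matrix (Fin N × Fin r) (Fin N × Fin p) ℝ)
    (S₃ : Matrix (Fin N × Fin r) ((Fin N × Fin p × Fin d) ⊕ (Fin N × Fin r)) ℝ) : Prop :=
  ExponentiallyStable M.τ
    {X : ℝ → (Fin N × Fin n → ℝ) × (Fin N × Fin p × Fin d → ℝ) × (Fin N × Fin r → ℝ) |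
      ∃ x z ξ u, (∀ t, X t = (x t, z t, ξ t)) ∧
        M.IsAugmentedTrajectory G₁ G₂ M.nominal x z u (fun _ => 0) ∧
        M.DynamicOutputFeedback K₁ K₂ S₁ S₂ S₃
          (M.auxOutput M.nominal x (fun _ => 0)) z ξ u}

/-- The dynamic state feedback law (internal model plus static state feedback), with controller
state `z`. -/
def dynamicStateLaw (M : LeaderFollowerNetwork N n m p q)
    (G₁ : Matrix (Fin p × Fin d) (Fin p × Fin d) ℝ) (G₂ : Matrix (Fin p × Fin d) (Fin p) ℝ)
    (Kx : Matrix (Fin N × Fin m) (Fin N × Fin n) ℝ)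
    (Kz : Matrix (Fin N × Fin m) (Fin N × Fin p × Fin d) ℝ) :
    ControlLaw N n m p (Fin N × Fin p × Fin d → ℝ) :=
  fun x ev z u => M.IsInternalModelTrajectory G₁ G₂ ev z ∧ M.StaticStateFeedback Kx Kz x z u

/-- The dynamic output feedback law containing the internal model, with controller state
`(z, ξ)`. -/
def dynamicOutputLaw (M : LeaderFollowerNetwork N n m p q)
    (G₁ : Matrix (Fin p × Fin d) (Fin p × Fin d) ℝ) (G₂ : Matrix (Fin p × Fin d) (Fin p) ℝ)
    (K₁ : Matrix (Fin N × Fin m) (Fin N × Fin p × Fin d) ℝ)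
    (K₂ : Matrix (Fin N × Fin m) (Fin N × Fin r) ℝ)
    (S₁ : Matrix (Fin N × Fin r) (Fin N × Fin r) ℝ)
    (S₂ : Matrix (Fin N × Fin r) (Fin N × Fin p) ℝ)
    (S₃ : Matrix (Fin N × Fin r) ((Fin N × Fin p × Fin d) ⊕ (Fin N × Fin r)) ℝ) :
    ControlLaw N n m p ((Fin N × Fin p × Fin d → ℝ) × (Fin N × Fin r → ℝ)) :=
  fun _ ev c u => M.IsInternalModelTrajectory G₁ G₂ ev (fun t => (c t).1) ∧
    M.DynamicOutputFeedback K₁ K₂ S₁ S₂ S₃ ev (fun t => (c t).1) (fun t => (c t).2) u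

/-! ### Robust output regulation of the auxiliary system -/

variable {E : Type} [NormedAddCommGroup E]

/-- Closed loop of the auxiliary system (with plant matrices `P`) and a control law. -/
def IsAuxClosedLoop (M : LeaderFollowerNetwork N n m p q) (law : ControlLaw N n m p E)
    (P : PlantMatrices N n m p q) (x : ℝ → Fin N × Fin n → ℝ) (c : ℝ → E)
    (v : ℝ → Fin q → ℝ) : Prop :=
  ∃ u, M.IsExosystemTrajectory v ∧ M.IsAuxTrajectory P x u v ∧ law x (M.auxOutput P x v) c u

/-- The control law solves the robust output regulation problem of the auxiliary system: the
nominal closed loop is exponentially stable when `v = 0`, and for all perturbations `w` in some open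
neighbourhood of `0` and all initial conditions `e_v(t) → 0`. -/
def SolvesAuxRobustRegulation (M : LeaderFollowerNetwork N n m p q)
    (law : ControlLaw N n m p E) : Prop :=
  ExponentiallyStable M.τ
    {X : ℝ → (Fin N × Fin n → ℝ) × E |
      ∃ x c, (∀ t, X t = (x t, c t)) ∧ M.IsAuxClosedLoop law M.nominal x c (fun _ => 0)} ∧
  ∃ W : Set (PlantMatrices N n m p q), IsOpen W ∧ 0 ∈ W ∧ ∀ w ∈ W, ∀ x c v,
    M.IsAuxClosedLoop law (M.nominal + w) x c v →
      Tendsto (M.auxOutput (M.nominal + w) x v) atTop (𝓝 0)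

/-! ### Cooperative robust output regulation of the multi-agent plant -/

/-- The outputs of all the nodes: `y₀ = -F v` and `y_i = C_i x_i`. -/
def nodeOutput (M : LeaderFollowerNetwork N n m p q) (P : PlantMatrices N n m p q)
    (x : ℝ → Fin N × Fin n → ℝ) (v : ℝ → Fin q → ℝ) (t : ℝ) : Fin (N + 1) → Fin p → ℝ :=
  Fin.cons (-(M.F *ᵥ v t)) (fun i => P.C i *ᵥ agent (x t) i)

/-- The regulated output `e_i = y_i - y₀` of follower `i`. -/
def regulatedOutput (M : LeaderFollowerNetwork N n m p q) (P : PlantMatrices N n m p q)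
    (x : ℝ → Fin N × Fin n → ℝ) (v : ℝ → Fin q → ℝ) (i : Fin N) (t : ℝ) : Fin p → ℝ :=
  M.nodeOutput P x v t i.succ - M.nodeOutput P x v t 0

/-- The virtual regulated outputs `e_vi = ∑_j a_ij (y_i - y_j)`, stacked.  (The weights of
non-neighbours vanish.) -/
def virtualOutput (M : LeaderFollowerNetwork N n m p q) (P : PlantMatrices N n m p q)
    (x : ℝ → Fin N × Fin n → ℝ) (v : ℝ → Fin q → ℝ) (t : ℝ) : Fin N × Fin p → ℝ :=
  fun k => ∑ j : Fin (N + 1), M.weight k.1.succ j *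
    (M.nodeOutput P x v t k.1.succ k.2 - M.nodeOutput P x v t j k.2)

/-- Each follower solves `x_i' = A_i x_i + B_i u_i(t - τcon) + E_i v` for `t ≥ 0`, with a continuous
initial function. -/
def IsPlantTrajectory (M : LeaderFollowerNetwork N n m p q) (P : PlantMatrices N n m p q)
    (x : ℝ → Fin N × Fin n → ℝ) (u : ℝ → Fin N × Fin m → ℝ) (v : ℝ → Fin q → ℝ) : Prop :=
  ∀ i : Fin N, ContinuousOn (fun t => agent (x t) i) (Ici (-M.τ)) ∧
    ∀ t, 0 ≤ t → HasDerivWithinAt (fun s => agent (x s) i)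
      (P.A i *ᵥ agent (x t) i + P.B i *ᵥ agent (u (t - M.τcon)) i + P.E i *ᵥ v t) (Ici 0) t

/-- Closed loop of the multi-agent plant (with plant matrices `P`) and a control law. -/
def IsPlantClosedLoop (M : LeaderFollowerNetwork N n m p q) (law : ControlLaw N n m p E)
    (P : PlantMatrices N n m p q) (x : ℝ → Fin N × Fin n → ℝ) (c : ℝ → E)
    (v : ℝ → Fin q → ℝ) : Prop :=
  ∃ u, M.IsExosystemTrajectory v ∧ M.IsPlantTrajectory P x u v ∧
    law x (M.virtualOutput P x v) c u

/-- The control law achieves cooperative robust output regulation: the nominal closed loop is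
exponentially stable when `v = 0`, and for all perturbations `w` in some open neighbourhood of `0`
and all initial conditions `e_i(t) → 0` for every follower `i`. -/
def SolvesCooperativeRobustRegulation (M : LeaderFollowerNetwork N n m p q)
    (law : ControlLaw N n m p E) : Prop :=
  ExponentiallyStable M.τ
    {X : ℝ → (Fin N × Fin n → ℝ) × E |
      ∃ x c, (∀ t, X t = (x t, c t)) ∧ M.IsPlantClosedLoop law M.nominal x c (fun _ => 0)} ∧
  ∃ W : Set (PlantMatrices N n m p q), IsOpen W ∧ 0 ∈ W ∧ ∀ w ∈ W, ∀ x c v,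
    M.IsPlantClosedLoop law (M.nominal + w) x c v →
      ∀ i, Tendsto (M.regulatedOutput (M.nominal + w) x v i) atTop (𝓝 0)

end LeaderFollowerNetwork

/-!
Both control laws are instances of one linear law (`linearLaw`), so that each closed loop is a linear
delay differential equation `X'(t) = ∑ i, A i (X (t - h i)) + ∑ i, B i (v (t - h i))` in finite
dimension with delays `0`, `τcom`, `τcon` and `τ`, whose coefficients depend continuously on the plant
matrices.

Robust stability (`ExponentiallyStable.eventually_tendsto_zero`): a solution of a nearby equation is
compared, on a window of fixed length, with the solution of the stable equation that has the same
initial function. The latter exists by a contraction argument and has decayed to a quarter of its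
size at the end of the window; the deviation is small by a Grönwall inequality with delays. So the
solution is halved from window to window.

Steady state (`exists_regulator_solution`, `tendsto_sub_regulator_solution`): the regulator equation
`Φ S = ∑ i, (A i Φ exp(-h i S) + B i exp(-h i S))` is affine in `Φ`, and its homogeneous part is
injective. Indeed a solution `Φ₀` of the homogeneous equation makes `Φ₀ exp(t S) v` a solution of the
delay equation, hence decaying, which is impossible for `Φ₀ ≠ 0` as the eigenvalues of `S` are
imaginary (`EigenvaluesOnImaginaryAxis.eq_zero_of_tendsto`). So the equation is solvable, and every
state of the closed loop is asymptotic to `Φ v`.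

Zero error (`eq_zero_of_internalModel`): the internal model component of the regulator equation reads
`ζ S = G₁ ζ + G₂ ξ`, where `ξ` is the delayed steady-state output. Evaluating the minimal polynomial
of `S`, which is the characteristic polynomial of `β`, gives `ξ = 0` by controllability of `(β, σ)`.
Hence `e_v → 0`.

Cooperative regulation: `e_v = (H ⊗ I) e`, and `H` is invertible by the maximum principle along the
spanning tree (`isUnit_det_H`), so that `e_v → 0` implies `e → 0`.
-/

/-! ### Linear delay differential equations -/

section DelayEquation

variable {ι E : Type*} [Fintype ι] [NormedAddCommGroup E] [NormedSpace ℝ E]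

/-- `X` solves `X'(t) = ∑ i, A i (X (t - h i))` for `t ≥ 0`, with a continuous initial function on
`[-r, 0]`. -/
def IsDelaySolution (r : ℝ) (h : ι → ℝ) (A : ι → E →L[ℝ] E) (X : ℝ → E) : Prop :=
  ContinuousOn X (Ici (-r)) ∧
    ∀ t, 0 ≤ t → HasDerivWithinAt X (∑ i, A i (X (t - h i))) (Ici 0) t

/-- A Grönwall inequality with delays: the supremum of `exp (-(2 * a + 1) * max t 0) * ‖D t‖`
is at most half of itself plus the contribution of the initial function and of the forcing. -/
lemma norm_le_of_norm_deriv_le_delay {r T a b δ : ℝ} {h c : ι → ℝ} {D D' : ℝ → E}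
    (hr : 0 ≤ r) (hT : 0 ≤ T) (hh : ∀ i, 0 ≤ h i ∧ h i ≤ r) (hc : ∀ i, 0 ≤ c i)
    (hca : ∑ i, c i ≤ a) (hδ : 0 ≤ δ) (hcont : ContinuousOn D (Icc (-r) T))
    (hder : ∀ t ∈ Ico 0 T, HasDerivWithinAt D (D' t) (Ici t) t)
    (hbound : ∀ t ∈ Ico 0 T, ‖D' t‖ ≤ ∑ i, c i * ‖D (t - h i)‖ + δ)
    (hb : ∀ θ ∈ Icc (-r) 0, ‖D θ‖ ≤ b) {t : ℝ} (ht : t ∈ Icc (-r) T) :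
    ‖D t‖ ≤ 2 * (b + δ * T) * Real.exp ((2 * a + 1) * T) := by
  have ha : 0 ≤ a := (Finset.sum_nonneg fun i _ => hc i).trans hca
  set l := 2 * a + 1 with hl
  have hl0 : 0 < l := by positivity
  have hb0 : 0 ≤ b := (norm_nonneg _).trans (hb 0 ⟨by linarith, le_rfl⟩)
  obtain ⟨s, hs, hmax⟩ := isCompact_Icc.exists_isMaxOn (s := Icc (-r) T) ⟨t, ht⟩
    (f := fun t => Real.exp (-(l * max t 0)) * ‖D t‖)
    (ContinuousOn.mul (by fun_prop) hcont.norm)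
  set K := Real.exp (-(l * max s 0)) * ‖D s‖ with hK
  have hK0 : 0 ≤ K := by positivity
  have hle : ∀ t ∈ Icc (-r) T, ‖D t‖ ≤ K * Real.exp (l * max t 0) := by
    intro t ht
    have h1 : Real.exp (-(l * max t 0)) * ‖D t‖ ≤ K := hmax ht
    calc ‖D t‖ = Real.exp (-(l * max t 0)) * ‖D t‖ * Real.exp (l * max t 0) := by
          rw [mul_right_comm, ← Real.exp_add]; simp
      _ ≤ _ := by gcongr
  have hKb : K ≤ 2 * (b + δ * T) := by
    rcases le_total s 0 with hs0 | hs0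
    · have : K = ‖D s‖ := by simp [hK, max_eq_right hs0]
      have := hb s ⟨hs.1, hs0⟩
      nlinarith [mul_nonneg hδ hT]
    · have key := image_norm_le_of_norm_deriv_right_le_deriv_boundary (f := D) (f' := D')
        (a := 0) (b := T) (B := fun t => b + a * K / l * (Real.exp (l * t) - 1) + δ * t)
        (B' := fun t => a * K * Real.exp (l * t) + δ)
        (hcont.mono (Icc_subset_Icc_left (by linarith))) hder
        (by simpa using hb 0 ⟨by linarith, le_rfl⟩)
        (fun t => by
          have h1 : HasDerivAt (fun t : ℝ => l * t) l t := by
            simpa using (hasDerivAt_id t).const_mul l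
          have h2 := (((h1.exp.sub_const 1).const_mul (a * K / l)).const_add b).add
            ((hasDerivAt_id t).const_mul δ)
          refine h2.congr_deriv ?_
          field_simp)
        (fun t ht => by
          refine (hbound t ht).trans ?_
          gcongr
          calc ∑ i, c i * ‖D (t - h i)‖ ≤ ∑ i, c i * (K * Real.exp (l * t)) := by
                refine Finset.sum_le_sum fun i _ => mul_le_mul_of_nonneg_left ?_ (hc i)
                refine (hle _ ⟨by linarith [ht.1, (hh i).2], by linarith [ht.2, (hh i).1]⟩).trans ?_
                gcongr
                exact max_le (by linarith [(hh i).1]) ht.1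
            _ = (∑ i, c i) * (K * Real.exp (l * t)) := by rw [Finset.sum_mul]
            _ ≤ a * (K * Real.exp (l * t)) := by gcongr
            _ = _ := by ring) (x := s) ⟨hs0, hs.2⟩
      have e1 : K * Real.exp (l * s) = ‖D s‖ := by
        rw [hK, max_eq_left hs0, mul_right_comm, ← Real.exp_add]; simp
      have e2 : 1 ≤ Real.exp (l * s) := Real.one_le_exp (by positivity)
      have e3 : a / l ≤ 1 / 2 := by rw [div_le_div_iff₀ hl0 two_pos]; linarith
      have e4 : a * K / l * (Real.exp (l * s) - 1) ≤ 1 / 2 * K * Real.exp (l * s) := by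
        calc a * K / l * (Real.exp (l * s) - 1) = a / l * (K * (Real.exp (l * s) - 1)) := by ring
          _ ≤ 1 / 2 * (K * (Real.exp (l * s) - 1)) := by
            gcongr
          _ ≤ _ := by nlinarith
      have e5 : δ * s ≤ δ * T := mul_le_mul_of_nonneg_left hs.2 hδ
      have e6 : K * Real.exp (l * s) ≤ 2 * (b + δ * T) := by linarith
      nlinarith
  refine (hle t ht).trans ?_
  have : max t 0 ≤ T := max_le ht.2 hT
  gcongr

/-- Linear delay equations have a solution for each continuous initial function `φ`.  With
`X = φ + exp (l * t) * Y`, the integral equation becomes a contraction for bounded continuous `Y`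
when `l` is large. -/
lemma exists_isDelaySolution [CompleteSpace E] {r : ℝ} (hr : 0 ≤ r) {h : ι → ℝ}
    (hh : ∀ i, 0 ≤ h i ∧ h i ≤ r) (A : ι → E →L[ℝ] E) {φ : ℝ → E}
    (hφ : ContinuousOn φ (Icc (-r) 0)) :
    ∃ X, IsDelaySolution r h A X ∧ EqOn X φ (Icc (-r) 0) := by
  have hr' : -r ≤ 0 := by linarith
  -- extend the initial function to a bounded continuous function on the line
  obtain ⟨ψ, hψc, hψ, hψ0, C, hC⟩ : ∃ ψ : ℝ → E, Continuous ψ ∧ EqOn ψ φ (Icc (-r) 0) ∧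
      (∀ t, 0 ≤ t → ψ t = ψ 0) ∧ ∃ C, ∀ t, ‖ψ t‖ ≤ C := by
    obtain ⟨C, hC⟩ := isCompact_Icc.exists_bound_of_continuousOn hφ
    refine ⟨IccExtend hr' (domRestrict (Icc (-r) 0) φ), ?_, ?_, ?_, C, ?_⟩
    · exact (continuousOn_iff_continuous_domRestrict.1 hφ).Icc_extend'
    · intro t ht; rw [IccExtend_of_mem _ _ ht]; rfl
    · intro t ht
      rw [IccExtend_of_right_le _ _ ht, IccExtend_of_right_le _ _ le_rfl]
    · intro t
      simp only [IccExtend, Function.comp_apply]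
      exact hC _ (Subtype.coe_prop _)
  have hC0 : 0 ≤ C := (norm_nonneg _).trans (hC 0)
  set a := ∑ i, ‖A i‖ with ha
  have ha0 : 0 ≤ a := Finset.sum_nonneg fun i _ => norm_nonneg _
  set l := 2 * a + 1 with hl
  have hl0 : 0 < l := by positivity
  -- the delayed right-hand side, in terms of an arbitrary function on the line
  set R : (ℝ → E) → ℝ → E := fun X s => ∑ i, A i (X (s - h i)) with hR
  have hRc : ∀ X : ℝ → E, Continuous X → Continuous (R X) := by
    intro X hX
    refine continuous_finsetSum _ fun i _ => (A i).continuous.comp (hX.comp (by fun_prop))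
  set U : (ℝ → E) → ℝ → E := fun Y s => ψ s + Real.exp (l * s) • Y s with hU
  have hUc : ∀ Y : ℝ → E, Continuous Y → Continuous (U Y) := fun Y hY => by
    simp only [hU]; fun_prop
  set Φ : (ℝ → E) → ℝ → E :=
    fun Y t => Real.exp (-(l * t)) • ∫ s in (0 : ℝ)..(max t 0), R (U Y) s with hΦ
  have hΦc : ∀ Y : ℝ → E, Continuous Y → Continuous (Φ Y) := fun Y hY => by
    have h1 : Continuous fun t => ∫ s in (0 : ℝ)..t, R (U Y) s :=
      intervalIntegral.continuous_primitive
        (fun a b => (hRc _ (hUc _ hY)).intervalIntegrable a b) 0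
    simp only [hΦ]
    exact (by fun_prop : Continuous fun t : ℝ => Real.exp (-(l * t))).smul
      (h1.comp (by fun_prop : Continuous fun t : ℝ => max t 0))
  have hRle : ∀ (X : ℝ → E) (s B : ℝ), (∀ t ≤ s, ‖X t‖ ≤ B) → ‖R X s‖ ≤ a * B := by
    intro X s B hB
    calc ‖R X s‖ ≤ ∑ i, ‖A i‖ * B := norm_sum_le_of_le _ fun i _ =>
          (A i).le_opNorm_of_le (hB _ (by linarith [(hh i).1]))
      _ = a * B := by rw [ha, Finset.sum_mul]
  have hexp : ∀ t, ∫ s in (0 : ℝ)..t, Real.exp (l * s) = (Real.exp (l * t) - 1) / l := by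
    intro t
    rw [intervalIntegral.integral_comp_mul_left (fun x => Real.exp x) hl0.ne', integral_exp]
    simp [div_eq_inv_mul]
  have hal : a / l ≤ 1 / 2 := by rw [div_le_div_iff₀ hl0 two_pos]; linarith
  -- a bound for the weighted primitive
  have hprim : ∀ (f : ℝ → E) (B : ℝ), 0 ≤ B → (∀ s, 0 ≤ s → ‖f s‖ ≤ a * (B * Real.exp (l * s))) →
      ∀ t, ‖Real.exp (-(l * t)) • ∫ s in (0 : ℝ)..(max t 0), f s‖ ≤ 1 / 2 * B := by
    intro f B hB hf t
    rcases le_total t 0 with ht | ht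
    · rw [max_eq_right ht]; simp; positivity
    rw [max_eq_left ht, norm_smul, Real.norm_of_nonneg (Real.exp_pos _).le]
    have h1 : ‖∫ s in (0 : ℝ)..t, f s‖ ≤ ∫ s in (0 : ℝ)..t, a * (B * Real.exp (l * s)) :=
      intervalIntegral.norm_integral_le_of_norm_le ht
        (Filter.Eventually.of_forall fun s hs => hf s hs.1.le)
        (Continuous.intervalIntegrable (by fun_prop) _ _)
    rw [intervalIntegral.integral_const_mul, intervalIntegral.integral_const_mul, hexp] at h1
    calc Real.exp (-(l * t)) * ‖∫ s in (0 : ℝ)..t, f s‖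
        ≤ Real.exp (-(l * t)) * (a * (B * ((Real.exp (l * t) - 1) / l))) := by gcongr
      _ ≤ Real.exp (-(l * t)) * (a * (B * (Real.exp (l * t) / l))) := by gcongr; linarith
      _ = a / l * B * (Real.exp (-(l * t)) * Real.exp (l * t)) := by ring
      _ = a / l * B := by rw [← Real.exp_add]; simp
      _ ≤ 1 / 2 * B := by gcongr
  have hΦb : ∀ Y : BoundedContinuousFunction ℝ E, ∀ t, ‖Φ Y t‖ ≤ 1 / 2 * (C + ‖Y‖) := by
    intro Y t
    refine hprim _ _ (by positivity) (fun s hs => hRle _ _ _ fun u hu => ?_) t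
    have e1 : 1 ≤ Real.exp (l * s) := Real.one_le_exp (by positivity)
    calc ‖U Y u‖ ≤ ‖ψ u‖ + Real.exp (l * u) * ‖Y u‖ := by
          refine (norm_add_le _ _).trans ?_
          rw [norm_smul, Real.norm_of_nonneg (Real.exp_pos _).le]
      _ ≤ C + Real.exp (l * s) * ‖Y‖ := by
          gcongr
          · exact hC u
          · exact Y.norm_coe_le_norm u
      _ ≤ _ := by nlinarith
  let Ψ : BoundedContinuousFunction ℝ E → BoundedContinuousFunction ℝ E := fun Y =>
    BoundedContinuousFunction.ofNormedAddCommGroup (Φ Y) (hΦc Y Y.continuous) _ (hΦb Y)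
  have hΨ : ContractingWith (1 / 2) Ψ := by
    refine ⟨by norm_num, LipschitzWith.of_dist_le_mul fun Y Z => ?_⟩
    rw [BoundedContinuousFunction.dist_le (by positivity)]
    intro t
    have hint : ∀ W : BoundedContinuousFunction ℝ E, ∀ u v : ℝ,
        IntervalIntegrable (R (U W)) MeasureTheory.volume u v :=
      fun W u v => (hRc _ (hUc _ W.continuous)).intervalIntegrable u v
    have e1 : Ψ Y t - Ψ Z t =
        Real.exp (-(l * t)) • ∫ s in (0 : ℝ)..(max t 0), R (U Y - U Z) s := by
      change Φ Y t - Φ Z t = _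
      simp only [hΦ]
      rw [← smul_sub, ← intervalIntegral.integral_sub (hint Y _ _) (hint Z _ _)]
      simp [hR, Finset.sum_sub_distrib]
    rw [dist_eq_norm, e1]
    simp only [NNReal.coe_div, NNReal.coe_one, NNReal.coe_ofNat]
    refine hprim _ _ dist_nonneg (fun s hs => hRle _ _ _ fun u hu => ?_) t
    have e2 : (U Y - U Z) u = Real.exp (l * u) • (Y u - Z u) := by
      simp [hU, smul_sub]
    rw [e2, norm_smul, Real.norm_of_nonneg (Real.exp_pos _).le, mul_comm, ← dist_eq_norm]
    gcongr
    exact BoundedContinuousFunction.dist_coe_le_dist u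
  obtain ⟨Y, hY⟩ : ∃ Y, Ψ Y = Y := ⟨_, hΨ.fixedPoint_isFixedPt⟩
  have hY' : ∀ t, Y t = Real.exp (-(l * t)) • ∫ s in (0 : ℝ)..(max t 0), R (U Y) s := fun t => by
    conv_lhs => rw [← hY]
    rfl
  have hX : ∀ t, U Y t = ψ t + ∫ s in (0 : ℝ)..(max t 0), R (U Y) s := fun t => by
    simp only [hU]
    rw [hY', smul_smul, ← Real.exp_add]
    simp [hU]
  refine ⟨U Y, ⟨(hUc _ Y.continuous).continuousOn, fun t ht => ?_⟩, fun t ht => ?_⟩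
  · have h1 : HasDerivAt (fun t => ψ 0 + ∫ s in (0 : ℝ)..t, R (U Y) s) (R (U Y) t) t :=
      (intervalIntegral.integral_hasDerivAt_right
        ((hRc _ (hUc _ Y.continuous)).intervalIntegrable _ _)
        ((hRc _ (hUc _ Y.continuous)).stronglyMeasurableAtFilter _ _)
        (hRc _ (hUc _ Y.continuous)).continuousAt).const_add _
    have h2 : ∀ s ∈ Ici (0 : ℝ), U Y s = ψ 0 + ∫ s in (0 : ℝ)..s, R (U Y) s := fun s hs => by
      rw [hX, max_eq_left hs, hψ0 s hs]
    exact h1.hasDerivWithinAt.congr h2 (h2 t ht)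
  · rw [hX, max_eq_right ht.2, intervalIntegral.integral_same, add_zero, hψ ht]

lemma IsDelaySolution.comp_add {r s : ℝ} {h : ι → ℝ} {A : ι → E →L[ℝ] E} {X : ℝ → E}
    (hX : IsDelaySolution r h A X) (hs : 0 ≤ s) : IsDelaySolution r h A fun t => X (t + s) := by
  refine ⟨hX.1.comp (by fun_prop) fun t ht => ?_, fun t ht => ?_⟩
  · simp only [mem_Ici] at *; linarith
  · have h1 := (hX.2 (t + s) (by linarith)).scomp t
      (((hasDerivAt_id t).add_const s).hasDerivWithinAt (s := Ici 0))
      (fun u hu => by simp only [mem_Ici, id] at *; linarith)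
    simpa [Function.comp_def, add_sub_right_comm] using h1

/-- The halving step of the robustness argument: over one window of length `T`, solutions of a
nearby equation stay close to the solution of the stable one with the same initial function. -/
lemma ExponentiallyStable.eventually_halving [CompleteSpace E] {r : ℝ} (hr : 0 ≤ r) {h : ι → ℝ}
    (hh : ∀ i, 0 ≤ h i ∧ h i ≤ r) {A : ι → E →L[ℝ] E}
    (hA : ExponentiallyStable r {X | IsDelaySolution r h A X}) :
    ∃ T C : ℝ, 0 < T ∧ ∀ᶠ A' in 𝓝 A, ∀ X, IsDelaySolution r h A' X → ∀ b : ℝ,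
      (∀ θ ∈ Icc (-r) 0, ‖X θ‖ ≤ b) →
        (∀ t ∈ Icc (-r) T, ‖X t‖ ≤ C * b) ∧ ∀ t ∈ Icc (T - r) T, ‖X t‖ ≤ b / 2 := by
  obtain ⟨κ, α, hα, hst⟩ := hA
  obtain ⟨T, hT0, hTr, hT⟩ : ∃ T : ℝ, 0 < T ∧ r ≤ T ∧ κ * Real.exp (-α * (T - r)) ≤ 1 / 4 := by
    have h1 : Tendsto (fun T : ℝ => κ * Real.exp (-α * (T - r))) atTop (𝓝 (κ * 0)) := by
      refine Tendsto.const_mul _ (Real.tendsto_exp_atBot.comp ?_)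
      exact (tendsto_id.atTop_add tendsto_const_nhds).const_mul_atTop_of_neg (by linarith)
    rw [mul_zero] at h1
    obtain ⟨T, h2, h3, h4⟩ := ((h1.eventually (ge_mem_nhds (by norm_num : (0 : ℝ) < 1 / 4))).and
      ((eventually_gt_atTop 0).and (eventually_ge_atTop r))).exists
    exact ⟨T, h3, h4, h2⟩
  set a := (∑ i, ‖A i‖) + 1 with ha
  set C := 2 * Real.exp ((2 * a + 1) * T) with hC
  have hC0 : 0 < C := by positivity
  -- the deviation is at most `ε * C * T * C * b ≤ b / 4`
  set ε := min 1 (1 / (4 * (C * T * C))) with hε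
  have hε0 : 0 < ε := by positivity
  refine ⟨T, C, hT0, ?_⟩
  have hnear : ∀ᶠ A' in 𝓝 A, ∑ i, ‖A' i - A i‖ < ε := by
    have : Continuous fun A' : ι → E →L[ℝ] E => ∑ i, ‖A' i - A i‖ := by fun_prop
    exact (this.tendsto A).eventually (gt_mem_nhds (by simpa using hε0))
  filter_upwards [hnear] with A' hA' X hX b hb
  have hb0 : 0 ≤ b := (norm_nonneg _).trans (hb 0 ⟨by linarith, le_rfl⟩)
  have hsum : ∑ i, ‖A' i‖ ≤ a := by
    have h1 : ∑ i, ‖A' i‖ ≤ ∑ i, (‖A' i - A i‖ + ‖A i‖) :=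
      Finset.sum_le_sum fun i _ => by simpa using norm_add_le (A' i - A i) (A i)
    rw [Finset.sum_add_distrib] at h1
    linarith [min_le_left 1 (1 / (4 * (C * T * C)))]
  have hsub : ∀ t : ℝ, 0 ≤ t → Ici t ⊆ Ici 0 := fun t ht => Ici_subset_Ici.2 ht
  have hXb : ∀ t ∈ Icc (-r) T, ‖X t‖ ≤ C * b := by
    intro t ht
    have := norm_le_of_norm_deriv_le_delay (δ := 0) hr hT0.le hh (fun i => norm_nonneg (A' i)) hsum
      le_rfl (hX.1.mono Icc_subset_Ici_self)
      (fun t ht => (hX.2 t ht.1).mono (hsub t ht.1))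
      (fun t _ => by
        rw [add_zero]
        exact norm_sum_le_of_le _ fun i _ => (A' i).le_opNorm _) hb ht
    simpa [hC, mul_right_comm] using this
  refine ⟨hXb, fun t ht => ?_⟩
  obtain ⟨Y, hY, hYX⟩ := exists_isDelaySolution hr hh A
    (hX.1.mono (Icc_subset_Ici_self : Icc (-r) 0 ⊆ _))
  have hYt : ‖Y t‖ ≤ 1 / 4 * b := by
    refine (hst Y hY b (fun θ hθ => hYX hθ ▸ hb θ hθ) t (by linarith [ht.1])).trans ?_
    have hκ : κ * Real.exp (-α * t) ≤ 1 / 4 := by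
      rcases le_total κ 0 with hκ | hκ
      · exact (mul_nonpos_of_nonpos_of_nonneg hκ (Real.exp_pos _).le).trans (by norm_num)
      · refine le_trans ?_ hT
        have : -α * t ≤ -α * (T - r) := by nlinarith [ht.1]
        gcongr
    gcongr
  have hD := norm_le_of_norm_deriv_le_delay (b := 0) (δ := ε * (C * b)) (a := a)
    (D := fun t => X t - Y t)
    (D' := fun t => ∑ i, A' i (X (t - h i)) - ∑ i, A i (Y (t - h i)))
    hr hT0.le hh (fun i => norm_nonneg (A i)) (by simp [ha]) (by positivity)
    ((hX.1.sub hY.1).mono Icc_subset_Ici_self)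
    (fun t ht => ((hX.2 t ht.1).sub (hY.2 t ht.1)).mono (hsub t ht.1))
    (fun t ht => by
      have h1 : ∑ i, A' i (X (t - h i)) - ∑ i, A i (Y (t - h i)) =
          ∑ i, A i (X (t - h i) - Y (t - h i)) + ∑ i, (A' i - A i) (X (t - h i)) := by
        rw [← Finset.sum_sub_distrib, ← Finset.sum_add_distrib]
        refine Finset.sum_congr rfl fun i _ => ?_
        simp only [map_sub, sub_apply]
        abel
      rw [h1]
      refine (norm_add_le _ _).trans (add_le_add
        (norm_sum_le_of_le _ fun i _ => (A i).le_opNorm _) ?_)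
      calc ‖∑ i, (A' i - A i) (X (t - h i))‖ ≤ ∑ i, ‖A' i - A i‖ * (C * b) :=
            norm_sum_le_of_le _ fun i _ => (A' i - A i).le_opNorm_of_le
              (hXb _ ⟨by linarith [ht.1, (hh i).2], by linarith [ht.2, (hh i).1]⟩)
        _ = (∑ i, ‖A' i - A i‖) * (C * b) := by rw [Finset.sum_mul]
        _ ≤ ε * (C * b) := by gcongr)
    (fun θ hθ => by simp [hYX hθ]) (t := t) ⟨by linarith [ht.1], ht.2⟩
  have hD' : ‖X t - Y t‖ ≤ 1 / 4 * b := by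
    refine hD.trans ?_
    have h1 : ε * (C * T * C) ≤ 1 / 4 := by
      calc ε * (C * T * C) ≤ 1 / (4 * (C * T * C)) * (C * T * C) := by
            gcongr; exact min_le_right _ _
        _ = 1 / 4 := by field_simp
    calc 2 * (0 + ε * (C * b) * T) * Real.exp ((2 * a + 1) * T)
        = ε * (C * T * C) * b := by rw [hC]; ring
      _ ≤ _ := by gcongr
  have := norm_add_le (X t - Y t) (Y t)
  rw [sub_add_cancel] at this
  linarith

/-- Exponential stability is robust: all solutions of the nearby equations decay. -/
theorem ExponentiallyStable.eventually_tendsto_zero [CompleteSpace E] {r : ℝ} (hr : 0 ≤ r)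
    {h : ι → ℝ} (hh : ∀ i, 0 ≤ h i ∧ h i ≤ r) {A : ι → E →L[ℝ] E}
    (hA : ExponentiallyStable r {X | IsDelaySolution r h A X}) :
    ∀ᶠ A' in 𝓝 A, ∀ X, IsDelaySolution r h A' X → Tendsto X atTop (𝓝 0) := by
  obtain ⟨T, C, hT, hev⟩ := hA.eventually_halving hr hh
  filter_upwards [hev] with A' hA' X hX
  obtain ⟨b, hb⟩ := isCompact_Icc.exists_bound_of_continuousOn
    (hX.1.mono (Icc_subset_Ici_self : Icc (-r) 0 ⊆ _))
  have hk : ∀ k : ℕ, ∀ θ ∈ Icc (-r) 0, ‖X (θ + k * T)‖ ≤ b / 2 ^ k := by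
    intro k
    induction k with
    | zero => simpa using hb
    | succ k ih =>
      intro θ hθ
      have h1 := (hA' _ (hX.comp_add (by positivity : 0 ≤ (k : ℝ) * T)) _ ih).2 (θ + T)
        ⟨by linarith [hθ.1], by linarith [hθ.2]⟩
      rw [pow_succ, ← div_div]
      convert h1 using 3
      push_cast; ring
  have hlim : Tendsto (fun t : ℝ => C * (b / 2 ^ ⌊t / T⌋₊)) atTop (𝓝 0) := by
    have h1 : Tendsto (fun k : ℕ => C * (b / 2 ^ k)) atTop (𝓝 (C * (b * 0))) := by
      simp_rw [div_eq_mul_inv, ← inv_pow]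
      exact ((tendsto_pow_atTop_nhds_zero_of_lt_one (by norm_num) (by norm_num)).const_mul
        b).const_mul C
    rw [mul_zero, mul_zero] at h1
    exact h1.comp (tendsto_nat_floor_atTop.comp (tendsto_id.atTop_div_const hT))
  refine squeeze_zero_norm' ?_ hlim
  filter_upwards [eventually_ge_atTop 0] with t ht
  have h1 : (⌊t / T⌋₊ : ℝ) * T ≤ t := by
    have := Nat.floor_le (div_nonneg ht hT.le)
    rwa [le_div_iff₀ hT] at this
  have h2 : t < (⌊t / T⌋₊ + 1 : ℝ) * T := by
    have := Nat.lt_floor_add_one (t / T)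
    rwa [div_lt_iff₀ hT] at this
  have h3 := (hA' _ (hX.comp_add (by positivity : 0 ≤ (⌊t / T⌋₊ : ℝ) * T)) _ (hk _)).1
    (t - ⌊t / T⌋₊ * T) ⟨by linarith, by linarith⟩
  simpa using h3

end DelayEquation

/-! ### The flow of the exosystem -/

section Exosystem

variable {q : ℕ}

/-- The flow `exp (t * S)` of `v' = S v`, as a continuous linear map. -/
noncomputable def exoFlow (S : Matrix (Fin q) (Fin q) ℝ) (t : ℝ) :
    (Fin q → ℝ) →L[ℝ] (Fin q → ℝ) :=
  NormedSpace.exp (t • S.mulVecLin.toContinuousLinearMap)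

lemma exoFlow_zero_apply (S : Matrix (Fin q) (Fin q) ℝ) (v : Fin q → ℝ) :
    exoFlow S 0 v = v := by
  simp [exoFlow]

lemma exoFlow_add_apply (S : Matrix (Fin q) (Fin q) ℝ) (s t : ℝ) (v : Fin q → ℝ) :
    exoFlow S (s + t) v = exoFlow S s (exoFlow S t v) := by
  have h : exoFlow S (s + t) = exoFlow S s * exoFlow S t := by
    let _ := NormedAlgebra.restrictScalars ℚ ℝ ((Fin q → ℝ) →L[ℝ] (Fin q → ℝ))
    rw [exoFlow, add_smul]
    exact NormedSpace.exp_add_of_commute (((Commute.refl _).smul_left s).smul_right t)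
  rw [h]; rfl

lemma exoFlow_mulVec (S : Matrix (Fin q) (Fin q) ℝ) (t : ℝ) (v : Fin q → ℝ) :
    exoFlow S t (S *ᵥ v) = S *ᵥ exoFlow S t v := by
  have h : Commute (exoFlow S t) S.mulVecLin.toContinuousLinearMap :=
    (((Commute.refl _).smul_right t).exp_right).symm
  exact DFunLike.congr_fun h.eq v

lemma hasDerivAt_exoFlow (S : Matrix (Fin q) (Fin q) ℝ) (t : ℝ) :
    HasDerivAt (exoFlow S) (S.mulVecLin.toContinuousLinearMap * exoFlow S t) t :=
  hasDerivAt_exp_smul_const' (𝕂 := ℝ) S.mulVecLin.toContinuousLinearMap t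

lemma hasDerivAt_exoFlow_apply (S : Matrix (Fin q) (Fin q) ℝ) (v : Fin q → ℝ) (t : ℝ) :
    HasDerivAt (fun t => exoFlow S t v) (S *ᵥ exoFlow S t v) t :=
  (ContinuousLinearMap.apply ℝ (Fin q → ℝ) v).hasFDerivAt.comp_hasDerivAt t
    (hasDerivAt_exoFlow S t)

lemma exoFlow_surjective (S : Matrix (Fin q) (Fin q) ℝ) (t : ℝ) :
    Function.Surjective (exoFlow S t) := fun v =>
  ⟨exoFlow S (-t) v, by rw [← exoFlow_add_apply]; simp [exoFlow_zero_apply]⟩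

/-- Solutions of `v' = S v` on `[0, ∞)` are given by the flow. -/
lemma eq_exoFlow_of_hasDerivWithinAt {S : Matrix (Fin q) (Fin q) ℝ} {v : ℝ → Fin q → ℝ}
    (hv : ∀ t, 0 ≤ t → HasDerivWithinAt v (S *ᵥ v t) (Ici 0) t) {t : ℝ} (ht : 0 ≤ t) :
    v t = exoFlow S t (v 0) := by
  have hd : ∀ s, 0 ≤ s → HasDerivWithinAt (fun s => exoFlow S (-s) (v s)) 0 (Ici 0) s := by
    intro s hs
    have h1 := ((hasDerivAt_exoFlow S (-s)).scomp s (hasDerivAt_neg s)).hasDerivWithinAt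
      (s := Ici 0)
    have h2 := h1.clm_apply (hv s hs)
    refine h2.congr_deriv ?_
    have h3 : (S.mulVecLin.toContinuousLinearMap * exoFlow S (-s)) (v s) =
      S *ᵥ exoFlow S (-s) (v s) := rfl
    simp only [Function.comp_apply, neg_smul, one_smul, neg_apply, h3, exoFlow_mulVec]
    simp
  have h1 := constant_of_has_deriv_right_zero (a := 0) (b := t)
    (fun s hs => (hd s hs.1).continuousWithinAt.mono Icc_subset_Ici_self)
    (fun s hs => (hd s hs.1).mono (Ici_subset_Ici.2 hs.1)) t ⟨ht, le_rfl⟩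
  simp only [neg_zero, exoFlow_zero_apply] at h1
  rw [← h1, ← exoFlow_add_apply]
  simp [exoFlow_zero_apply]

lemma eq_exoFlow_neg_of_hasDerivWithinAt {S : Matrix (Fin q) (Fin q) ℝ} {v : ℝ → Fin q → ℝ}
    (hv : ∀ t, 0 ≤ t → HasDerivWithinAt v (S *ᵥ v t) (Ici 0) t) {t s : ℝ}
    (ht : 0 ≤ t) (hs0 : 0 ≤ t - s) :
    v (t - s) = exoFlow S (-s) (v t) := by
  rw [eq_exoFlow_of_hasDerivWithinAt hv ht, eq_exoFlow_of_hasDerivWithinAt hv hs0,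
    ← exoFlow_add_apply]
  congr 1; ring_nf

/-- No nonzero linear functional decays along all the trajectories of an exosystem with imaginary
eigenvalues.  The complex functionals that do form an `S`-invariant subspace; if it were nonzero it
would contain an eigenvector `w`, and `‖w ⬝ v(t)‖` is constant because its eigenvalue is
imaginary. -/
lemma EigenvaluesOnImaginaryAxis.eq_zero_of_tendsto {S : Matrix (Fin q) (Fin q) ℝ}
    (hS : EigenvaluesOnImaginaryAxis S) (f : (Fin q → ℝ) →ₗ[ℝ] ℝ)
    (hf : ∀ v, Tendsto (fun t => f (exoFlow S t v)) atTop (𝓝 0)) : f = 0 := by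
  let SC : Matrix (Fin q) (Fin q) ℂ := S.map (algebraMap ℝ ℂ)
  let ev : (Fin q → ℂ) → (Fin q → ℝ) → ℂ := fun w v => w ⬝ᵥ fun i => (v i : ℂ)
  have hev : ∀ w v, ev (w ᵥ* SC) v = ev w (S *ᵥ v) := by
    intro w v
    simp only [ev, ← Matrix.dotProduct_mulVec]
    congr 1
    ext i
    simp [SC, Matrix.mulVec, dotProduct]
  let K : Submodule ℂ (Fin q → ℂ) :=
    { carrier := {w | ∀ v, Tendsto (fun t => ev w (exoFlow S t v)) atTop (𝓝 0)}
      zero_mem' := fun v => by simp [ev]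
      add_mem' := fun {a b} ha hb v => by
        simpa [ev, add_dotProduct] using (ha v).add (hb v)
      smul_mem' := fun c a ha v => by
        simpa [ev, smul_dotProduct] using (ha v).const_mul c }
  have hKS : ∀ w ∈ K, SC.vecMulLinear w ∈ K := by
    intro w hw v
    simpa [hev, exoFlow_mulVec] using hw (S *ᵥ v)
  have hK : K = ⊥ := by
    by_contra hne
    have : Nontrivial K := Submodule.nontrivial_iff_ne_bot.2 hne
    obtain ⟨μ, hμ⟩ := Module.End.exists_eigenvalue (SC.vecMulLinear.restrict hKS)
    obtain ⟨w, hw⟩ := hμ.exists_hasEigenvector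
    have hw0 : (w : Fin q → ℂ) ≠ 0 := fun h => hw.2 (Subtype.ext h)
    have hwS : (w : Fin q → ℂ) ᵥ* SC = μ • (w : Fin q → ℂ) :=
      congrArg Subtype.val hw.apply_eq_smul
    have hμre : μ.re = 0 := by
      refine hS μ fun hu => hw0 ?_
      have h1 : (w : Fin q → ℂ) ᵥ* (algebraMap ℂ _ μ - SC) = 0 := by
        rw [Matrix.vecMul_sub, hwS, Matrix.algebraMap_eq_diagonal]
        ext i
        simp [Matrix.vecMul_diagonal, mul_comm]
      have := Matrix.vecMul_injective_of_isUnit hu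
      exact this (h1.trans (Matrix.zero_vecMul _).symm)
    refine hw0 ?_
    have hzero : ∀ v, ev w v = 0 := by
      intro v
      set g : ℝ → ℂ := fun t => ev w (exoFlow S t v) with hg
      have hgd : ∀ t, HasDerivAt g (μ * g t) t := by
        intro t
        have h1 : HasDerivAt g (ev w (S *ᵥ exoFlow S t v)) t := by
          simp only [hg, ev, dotProduct]
          refine HasDerivAt.fun_sum fun i _ => HasDerivAt.const_mul _ ?_
          exact (hasDerivAt_pi.1 (hasDerivAt_exoFlow_apply S v t) i).ofReal_comp
        refine h1.congr_deriv ?_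
        rw [← hev, hwS]
        simp [ev, hg, smul_dotProduct]
      -- `exp (-μ t) g(t)` is constant
      have hcd : ∀ t, HasDerivAt (fun t : ℝ => Complex.exp (-μ * t) * g t) 0 t := by
        intro t
        have h1 : HasDerivAt (fun t : ℝ => -μ * (t : ℂ)) (-μ) t := by
          simpa using (Complex.ofRealCLM.hasDerivAt (x := t)).const_mul (-μ)
        refine (h1.cexp.mul (hgd t)).congr_deriv ?_
        ring
      have hconst : ∀ t : ℝ, Complex.exp (-μ * t) * g t = g 0 := by
        intro t
        have := is_const_of_deriv_eq_zero (fun t => (hcd t).differentiableAt)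
          (fun t => (hcd t).deriv) t 0
        simpa using this
      have hnorm : ∀ t, ‖g t‖ = ‖g 0‖ := by
        intro t
        rw [← hconst t, norm_mul, Complex.norm_exp]
        simp [hμre]
      have h2 : Tendsto (fun t => ‖g t‖) atTop (𝓝 0) := by simpa using (w.2 v).norm
      simp only [hnorm] at h2
      have h3 : g 0 = 0 := norm_eq_zero.1 (tendsto_nhds_unique tendsto_const_nhds h2)
      simpa [hg, exoFlow_zero_apply] using h3
    ext i
    have := hzero (Pi.single i 1)
    have e : (fun j => (((Pi.single i 1 : Fin q → ℝ) j : ℝ) : ℂ)) = Pi.single i 1 := by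
      ext j; by_cases hj : j = i <;> simp [hj]
    simpa [ev, e] using this
  have hfK : (fun i => ((f (Pi.single i 1) : ℝ) : ℂ)) ∈ K := by
    intro v
    have h1 := (Complex.continuous_ofReal.tendsto 0).comp (hf v)
    rw [Complex.ofReal_zero] at h1
    refine h1.congr fun t => ?_
    simp only [Function.comp_apply, ev, dotProduct]
    rw [LinearMap.pi_apply_eq_sum_univ f]
    have e : ∀ i : Fin q, (fun j => if i = j then (1 : ℝ) else 0) = Pi.single i 1 := fun i => by
      ext j; simp [Pi.single_apply, eq_comm]
    simp [e, mul_comm]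
  rw [hK, Submodule.mem_bot] at hfK
  refine LinearMap.pi_ext' fun i => LinearMap.ext_ring ?_
  have := congrFun hfK i
  simpa using this

end Exosystem

/-! ### Forced delay equations and the regulator equation -/

section Forced

variable {ι E : Type*} [Fintype ι] [NormedAddCommGroup E] [NormedSpace ℝ E] {q : ℕ}

/-- The regulator equation has a solution `Φ`.  Its homogeneous part is injective, since a
solution `Φ₀` of the homogeneous equation yields the solutions `Φ₀ (exp (t * S) v)` of the delay
equation, which decay. -/
lemma exists_regulator_solution [FiniteDimensional ℝ E] {r : ℝ} {h : ι → ℝ} {A : ι → E →L[ℝ] E}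
    (hA : ∀ X, IsDelaySolution r h A X → Tendsto X atTop (𝓝 0))
    {S : Matrix (Fin q) (Fin q) ℝ} (hS : EigenvaluesOnImaginaryAxis S)
    (B : ι → (Fin q → ℝ) →ₗ[ℝ] E) :
    ∃ Φ : (Fin q → ℝ) →ₗ[ℝ] E, ∀ v,
      Φ (S *ᵥ v) = ∑ i, (A i (Φ (exoFlow S (-h i) v)) + B i (exoFlow S (-h i) v)) := by
  let L : ((Fin q → ℝ) →ₗ[ℝ] E) →ₗ[ℝ] ((Fin q → ℝ) →ₗ[ℝ] E) :=
    LinearMap.lcomp ℝ E S.mulVecLin -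
      ∑ i, LinearMap.lcomp ℝ E (exoFlow S (-h i) : (Fin q → ℝ) →ₗ[ℝ] (Fin q → ℝ)) ∘ₗ
        LinearMap.llcomp ℝ (Fin q → ℝ) E E (A i : E →ₗ[ℝ] E)
  have hL : ∀ Φ v, L Φ v = Φ (S *ᵥ v) - ∑ i, A i (Φ (exoFlow S (-h i) v)) := by
    intro Φ v
    simp [L, LinearMap.sum_apply]
  have hinj : Function.Injective L := by
    rw [← LinearMap.ker_eq_bot, LinearMap.ker_eq_bot']
    intro Φ hΦ
    have hsol : ∀ v, IsDelaySolution r h A fun t => Φ (exoFlow S t v) := by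
      intro v
      have hd : ∀ t, HasDerivAt (fun t => Φ (exoFlow S t v)) (Φ (S *ᵥ exoFlow S t v)) t :=
        fun t => Φ.toContinuousLinearMap.hasFDerivAt.comp_hasDerivAt t
          (hasDerivAt_exoFlow_apply S v t)
      refine ⟨fun t _ => (hd t).continuousAt.continuousWithinAt, fun t _ => ?_⟩
      refine (hd t).hasDerivWithinAt.congr_deriv ?_
      have h1 := hL Φ (exoFlow S t v)
      rw [hΦ, LinearMap.zero_apply, eq_comm, sub_eq_zero] at h1
      simp [h1, ← exoFlow_add_apply, sub_eq_neg_add]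
    have hcoord : ∀ j, (Module.finBasis ℝ E).coord j ∘ₗ Φ = 0 := by
      intro j
      refine hS.eq_zero_of_tendsto _ fun v => ?_
      have h1 := (((Module.finBasis ℝ E).coord j).continuous_of_finiteDimensional.tendsto 0).comp
        (hA _ (hsol v))
      simpa [Function.comp_def] using h1
    ext1 v
    refine LinearMap.ext_ring ?_
    refine (Module.finBasis ℝ E).ext_elem fun j => ?_
    have := LinearMap.congr_fun (hcoord j) (LinearMap.single ℝ _ v 1)
    simpa using this
  obtain ⟨Φ, hΦ⟩ := LinearMap.injective_iff_surjective.1 hinj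
    (∑ i, B i ∘ₗ (exoFlow S (-h i) : (Fin q → ℝ) →ₗ[ℝ] (Fin q → ℝ)))
  refine ⟨Φ, fun v => ?_⟩
  have h1 := hL Φ v
  rw [hΦ, eq_comm, sub_eq_iff_eq_add] at h1
  rw [h1, Finset.sum_add_distrib, add_comm]
  simp [LinearMap.sum_apply]

/-- The states of the forced equation are asymptotic to `Φ v`, for each solution `Φ` of the
regulator equation.  As the past of `v` on `[-r, 0]` is arbitrary, `X - Φ v` satisfies the
homogeneous equation only from time `r` on. -/
lemma tendsto_sub_regulator_solution {r : ℝ} (hr : 0 ≤ r) {h : ι → ℝ}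
    (hh : ∀ i, 0 ≤ h i ∧ h i ≤ r) {A : ι → E →L[ℝ] E}
    (hA : ∀ X, IsDelaySolution r h A X → Tendsto X atTop (𝓝 0))
    {S : Matrix (Fin q) (Fin q) ℝ} {B : ι → (Fin q → ℝ) →ₗ[ℝ] E} {Φ : (Fin q → ℝ) →ₗ[ℝ] E}
    (hΦ : ∀ v,
      Φ (S *ᵥ v) = ∑ i, (A i (Φ (exoFlow S (-h i) v)) + B i (exoFlow S (-h i) v)))
    {X : ℝ → E} {v : ℝ → Fin q → ℝ}
    (hv : ∀ t, 0 ≤ t → HasDerivWithinAt v (S *ᵥ v t) (Ici 0) t)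
    (hX : ∀ t, 0 ≤ t →
      HasDerivWithinAt X (∑ i, (A i (X (t - h i)) + B i (v (t - h i)))) (Ici 0) t) :
    Tendsto (fun t => X t - Φ (v t)) atTop (𝓝 0) := by
  set D : ℝ → E := fun t => X t - Φ (v t) with hD
  have hder : ∀ t, 0 ≤ t → HasDerivWithinAt D
      (∑ i, (A i (X (t - h i)) + B i (v (t - h i))) - Φ (S *ᵥ v t)) (Ici 0) t := fun t ht =>
    (hX t ht).sub (Φ.toContinuousLinearMap.hasFDerivAt.comp_hasDerivWithinAt t (hv t ht))
  have hsol : IsDelaySolution r h A fun t => D (t + r) := by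
    refine ⟨?_, fun t ht => ?_⟩
    · have hc : ContinuousOn D (Ici 0) := fun t ht => (hder t ht).continuousWithinAt
      exact hc.comp (by fun_prop) fun t ht => by simp only [mem_Ici] at *; linarith
    · have h1 := (hder (t + r) (by linarith)).scomp t
        (((hasDerivAt_id t).add_const r).hasDerivWithinAt (s := Ici 0))
        (fun u hu => by simp only [mem_Ici, id] at *; linarith)
      refine (h1.congr_deriv ?_)
      rw [one_smul, hΦ, ← Finset.sum_sub_distrib]
      refine Finset.sum_congr rfl fun i _ => ?_
      have h2 : v (t + r - h i) = exoFlow S (-h i) (v (t + r)) :=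
        eq_exoFlow_neg_of_hasDerivWithinAt hv (by linarith)
          (by linarith [(hh i).2])
      have h3 : t - h i + r = t + r - h i := by ring
      simp [hD, h2, h3]
  have h1 := (hA _ hsol).comp (tendsto_atTop_add_const_right _ (-r) tendsto_id)
  simpa [Function.comp_def] using h1

end Forced

/-! ### The internal model principle -/

section InternalModel

variable {N p q d : ℕ}

/-- A functional that reads off the coordinate along `β ^ d σ` in the basis `σ, βσ, …, β ^ d σ` of
the `d + 1`-dimensional state space. -/
lemma IsControllablePair.exists_dual {β : Matrix (Fin (d + 1)) (Fin (d + 1)) ℝ}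
    {σ : Fin (d + 1) → ℝ} (h : IsControllablePair β σ) :
    ∃ f : Fin (d + 1) → ℝ, f ⬝ᵥ (β ^ d) *ᵥ σ = 1 ∧ ∀ k < d, f ⬝ᵥ (β ^ k) *ᵥ σ = 0 := by
  set Q : Matrix (Fin (d + 1)) (Fin (d + 1)) ℝ :=
    Matrix.of fun i k => ((β ^ (k : ℕ)) *ᵥ σ) i with hQ
  have hu : IsUnit Q := by
    have h1 : LinearIndependent ℝ Q.col := by
      rw [linearIndependent_iff_card_eq_finrank_span, Set.finrank, ← Matrix.rank_eq_finrank_span_cols]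
      rw [IsControllablePair] at h
      simp [hQ, h]
    exact Matrix.linearIndependent_cols_iff_isUnit.1 h1
  have hmul : ∀ k : Fin (d + 1), Q⁻¹ (Fin.last d) ⬝ᵥ (β ^ (k : ℕ)) *ᵥ σ =
      (1 : Matrix (Fin (d + 1)) (Fin (d + 1)) ℝ) (Fin.last d) k := by
    intro k
    rw [← Matrix.nonsing_inv_mul Q ((Matrix.isUnit_iff_isUnit_det _).1 hu), Matrix.mul_apply]
    rfl
  refine ⟨Q⁻¹ (Fin.last d), by simpa using hmul (Fin.last d), fun k hk => ?_⟩
  have := hmul ⟨k, by omega⟩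
  rw [this, Matrix.one_apply_ne]
  exact fun h => by simp [Fin.ext_iff] at h; omega

/-- The key property of the internal model: a driven copy of the exosystem has a response of the
form `ζ v` only if its input `ξ v` vanishes.  With the functional `f` of
`IsControllablePair.exists_dual`, `f ζ S ^ k = f β ^ k ζ` for `k < d` and
`f ζ S ^ d = f β ^ d ζ + ξ`; the minimal polynomial of `S` annihilates both sides. -/
lemma eq_zero_of_internalModel {S : Matrix (Fin q) (Fin q) ℝ} {β : Matrix (Fin d) (Fin d) ℝ}
    {σ : Fin d → ℝ} (hβ : β.charpoly = minpoly ℝ S) (hσ : IsControllablePair β σ)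
    (ζ : (Fin q → ℝ) →ₗ[ℝ] (Fin d → ℝ)) (ξ : (Fin q → ℝ) →ₗ[ℝ] ℝ)
    (h : ∀ v, ζ (S *ᵥ v) = β *ᵥ ζ v + ξ v • σ) : ξ = 0 := by
  have hS : Polynomial.aeval S β.charpoly = 0 := by rw [hβ]; exact minpoly.aeval ℝ S
  have hdeg : β.charpoly.natDegree = d := by simp [Matrix.charpoly_natDegree_eq_dim]
  cases d with
  | zero =>
    ext1 i
    refine LinearMap.ext_ring ?_
    have h1 : (1 : Matrix (Fin q) (Fin q) ℝ) = 0 := by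
      rw [← hS]; simp [Matrix.charpoly, Matrix.det_isEmpty]
    have h2 : (LinearMap.single ℝ (fun _ : Fin q => ℝ) i 1 : Fin q → ℝ) = 0 := by
      rw [← Matrix.one_mulVec (LinearMap.single ℝ (fun _ : Fin q => ℝ) i 1), h1,
        Matrix.zero_mulVec]
    rw [LinearMap.comp_apply, h2]
    simp
  | succ d =>
    obtain ⟨f, hf1, hf0⟩ := hσ.exists_dual
    have hstep : ∀ k v, f ⬝ᵥ (β ^ k) *ᵥ ζ (S *ᵥ v) =
        f ⬝ᵥ (β ^ (k + 1)) *ᵥ ζ v + ξ v * (f ⬝ᵥ (β ^ k) *ᵥ σ) := by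
      intro k v
      rw [h, Matrix.mulVec_add, Matrix.mulVec_mulVec, ← pow_succ, Matrix.mulVec_smul,
        dotProduct_add, dotProduct_smul, smul_eq_mul]
    have hlow : ∀ k ≤ d, ∀ v, f ⬝ᵥ ζ ((S ^ k) *ᵥ v) = f ⬝ᵥ (β ^ k) *ᵥ ζ v := by
      intro k
      induction k with
      | zero => simp
      | succ k ih =>
        intro hk v
        rw [pow_succ, ← Matrix.mulVec_mulVec, ih (by omega), hstep, hf0 k (by omega)]
        simp
    have htop : ∀ v, f ⬝ᵥ ζ ((S ^ (d + 1)) *ᵥ v) = f ⬝ᵥ (β ^ (d + 1)) *ᵥ ζ v + ξ v := by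
      intro v
      rw [pow_succ, ← Matrix.mulVec_mulVec, hlow d le_rfl, hstep, hf1, mul_one]
    have hlead : β.charpoly.coeff (d + 1) = 1 := by
      have := β.charpoly_monic.coeff_natDegree
      rwa [hdeg] at this
    refine LinearMap.ext fun v => ?_
    have h1 : f ⬝ᵥ ζ ((Polynomial.aeval S β.charpoly) *ᵥ v) =
        f ⬝ᵥ (Polynomial.aeval β β.charpoly) *ᵥ ζ v + ξ v := by
      simp only [Polynomial.aeval_eq_sum_range, hdeg, Matrix.sum_mulVec, Matrix.smul_mulVec,
        map_sum, map_smul, dotProduct_sum, dotProduct_smul, smul_eq_mul]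
      rw [Finset.sum_range_succ, Finset.sum_range_succ _ (d + 1), htop, hlead, one_mul, one_mul,
        ← add_assoc]
      congr 2
      refine Finset.sum_congr rfl fun k hk => ?_
      rw [hlow k (by simpa [Nat.lt_succ_iff] using hk)]
    rw [hS, Matrix.aeval_self_charpoly] at h1
    simpa using h1.symm

lemma one_kronecker_mulVec_apply {κ μ : Type*} [Fintype κ] [Fintype μ]
    (B : Matrix κ μ ℝ) (y : Fin N × μ → ℝ) (i : Fin N) (k : κ) :
    (((1 : Matrix (Fin N) (Fin N) ℝ) ⊗ₖ B) *ᵥ y) (i, k) = (B *ᵥ fun l => y (i, l)) k := by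
  simp only [Matrix.mulVec, dotProduct, Fintype.sum_prod_type, Matrix.kroneckerMap_apply]
  rw [Finset.sum_eq_single i]
  · simp
  · intro j _ hj; simp [Matrix.one_apply_ne hj.symm]
  · simp

/-- The stacked form of `eq_zero_of_internalModel`, one copy of the exosystem for each component of
each agent's virtual output. -/
lemma IsMinimalInternalModel.eq_zero {S : Matrix (Fin q) (Fin q) ℝ}
    {G₁ : Matrix (Fin p × Fin d) (Fin p × Fin d) ℝ} {G₂ : Matrix (Fin p × Fin d) (Fin p) ℝ}
    (hG : IsMinimalInternalModel S G₁ G₂) (ζ : (Fin q → ℝ) →ₗ[ℝ] (Fin N × Fin p × Fin d → ℝ))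
    (ξ : (Fin q → ℝ) →ₗ[ℝ] (Fin N × Fin p → ℝ))
    (h : ∀ v, ζ (S *ᵥ v) = ((1 : Matrix (Fin N) (Fin N) ℝ) ⊗ₖ G₁) *ᵥ ζ v +
      ((1 : Matrix (Fin N) (Fin N) ℝ) ⊗ₖ G₂) *ᵥ ξ v) : ξ = 0 := by
  obtain ⟨β, σ, hβ, hσ, rfl, rfl⟩ := hG
  refine LinearMap.ext fun v => funext fun ⟨i, l⟩ => ?_
  have h1 := eq_zero_of_internalModel hβ hσ
    (LinearMap.funLeft ℝ ℝ (fun k : Fin d => (i, l, k)) ∘ₗ ζ) (LinearMap.proj (i, l) ∘ₗ ξ) ?_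
  · exact LinearMap.congr_fun h1 v
  · intro v
    ext k
    have h2 := congrFun (h v) (i, l, k)
    rw [Pi.add_apply, one_kronecker_mulVec_apply, one_kronecker_mulVec_apply,
      one_kronecker_mulVec_apply] at h2
    simp only [LinearMap.comp_apply, LinearMap.funLeft_apply, h2, LinearMap.proj_apply,
      Pi.add_apply, Pi.smul_apply, smul_eq_mul]
    congr 1
    simp [Matrix.mulVec, dotProduct, mul_comm]

end InternalModel

/-! ### The network and the stacked system -/

lemma stackDiag_mulVec_apply {N k l : ℕ} (D : Fin N → Matrix (Fin k) (Fin l) ℝ)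
    (x : Fin N × Fin l → ℝ) (i : Fin N) (j : Fin k) :
    (stackDiag D *ᵥ x) (i, j) = (D i *ᵥ agent x i) j := by
  simp only [Matrix.mulVec, dotProduct, Fintype.sum_prod_type, stackDiag, Matrix.submatrix_apply,
    Prod.swap_prod_mk, Matrix.blockDiagonal_apply, agent]
  rw [Finset.sum_eq_single i]
  · simp
  · intro b _ hb; simp [hb.symm]
  · simp

namespace LeaderFollowerNetwork

variable {N n m p q : ℕ} (M : LeaderFollowerNetwork N n m p q)

lemma H_mulVec_apply (x : Fin N → ℝ) (i : Fin N) :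
    (M.H *ᵥ x) i = (∑ j, M.weight i.succ j) * x i - ∑ j : Fin N, M.weight i.succ j.succ * x j := by
  simp [H, laplacian, Matrix.mulVec, dotProduct, Matrix.diagonal_apply, sub_mul, ite_mul]

/-- `H x` in terms of differences along edges, with the value `0` at the leader. -/
lemma H_mulVec_apply_eq_sum_sub (y : Fin (N + 1) → ℝ) (i : Fin N) :
    (M.H *ᵥ fun j => y j.succ - y 0) i = ∑ j, M.weight i.succ j * (y i.succ - y j) := by
  rw [H_mulVec_apply, Fin.sum_univ_succ, Fin.sum_univ_succ]
  simp only [mul_sub, Finset.sum_sub_distrib, ← Finset.sum_mul]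
  ring

/-- A maximum principle: if `∑ j, a_ij (y i - y j) = 0` at all followers, then a maximum is passed
on from each node to its neighbours, hence to the leader. -/
lemma le_leader_of_harmonic (hT : HasDirectedSpanningTree M.graph 0) {y : Fin (N + 1) → ℝ}
    (hy : ∀ i : Fin N, ∑ j, M.weight i.succ j * (y i.succ - y j) = 0) (i : Fin (N + 1)) :
    y i ≤ y 0 := by
  obtain ⟨T, hTG, -, -, hreach⟩ := hT
  obtain ⟨k, hk⟩ := Finite.exists_max y
  have hedge : ∀ a b, T.Adj a b → y b = y k → y a = y k := by
    intro a b hab hb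
    have hadj : M.graph.Adj a b := hTG hab
    obtain ⟨c, rfl⟩ := Fin.exists_succ_eq.2 (fun h => M.graph_leader a (h ▸ hadj) : b ≠ 0)
    have h1 := (Finset.sum_eq_zero_iff_of_nonneg fun j _ =>
      mul_nonneg (M.weight_nonneg c.succ j) (by rw [hb]; linarith [hk j])).1 (hy c) a
      (Finset.mem_univ _)
    rcases mul_eq_zero.1 h1 with h2 | h2
    · exact absurd h2 ((M.weight_pos_iff _ _).2 hadj).ne'
    · linarith
  have hroot : ∀ b, Relation.ReflTransGen T.Adj 0 b → y b = y k → y 0 = y k := by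
    intro b hb
    induction hb with
    | refl => exact id
    | tail _ hbc ih => exact fun h => ih (hedge _ _ hbc h)
  rw [hroot k (hreach k) rfl]
  exact hk i

lemma isUnit_det_H (hT : HasDirectedSpanningTree M.graph 0) : IsUnit M.H.det := by
  rw [← Matrix.isUnit_iff_isUnit_det, ← Matrix.mulVec_injective_iff_isUnit]
  refine (injective_iff_map_eq_zero M.H.mulVecLin).2 fun x hx => ?_
  have hx' : M.H *ᵥ x = 0 := hx
  set y : Fin (N + 1) → ℝ := Fin.cons 0 x with hy
  have h1 : ∀ i : Fin N, ∑ j, M.weight i.succ j * (y i.succ - y j) = 0 := fun i => by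
    rw [← H_mulVec_apply_eq_sum_sub]
    simp [hy, hx']
  have h2 : ∀ i : Fin N, ∑ j, M.weight i.succ j * ((-y) i.succ - (-y) j) = 0 := fun i => by
    rw [← neg_eq_zero, ← Finset.sum_neg_distrib, ← h1 i]
    refine Finset.sum_congr rfl fun j _ => ?_
    simp only [Pi.neg_apply]; ring
  ext i
  have h3 := M.le_leader_of_harmonic hT h1 i.succ
  have h4 := M.le_leader_of_harmonic hT h2 i.succ
  simp only [hy, Pi.neg_apply, Fin.cons_succ, Fin.cons_zero] at h3 h4
  simp only [Pi.zero_apply]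
  linarith

lemma virtualOutput_apply (P : PlantMatrices N n m p q) (x : ℝ → Fin N × Fin n → ℝ)
    (v : ℝ → Fin q → ℝ) (t : ℝ) (i : Fin N) (l : Fin p) :
    M.virtualOutput P x v t (i, l) = (M.H *ᵥ fun j => M.regulatedOutput P x v j t l) i :=
  (M.H_mulVec_apply_eq_sum_sub (fun j => M.nodeOutput P x v t j l) i).symm

lemma virtualOutput_eq_auxOutput (P : PlantMatrices N n m p q) (x : ℝ → Fin N × Fin n → ℝ)
    (v : ℝ → Fin q → ℝ) : M.virtualOutput P x v = M.auxOutput P x v := by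
  ext t ⟨i, l⟩
  have h1 : ((M.H ⊗ₖ (1 : Matrix (Fin p) (Fin p) ℝ)) *ᵥ (stackDiag P.C *ᵥ x t)) (i, l) =
      (M.H *ᵥ fun j => (P.C j *ᵥ agent (x t) j) l) i := by
    simp only [← stackDiag_mulVec_apply]
    simp [Matrix.mulVec, dotProduct, Fintype.sum_prod_type, Matrix.kroneckerMap_apply,
      Matrix.one_apply]
  have h2 : (M.tildeF *ᵥ v t) (i, l) = M.weight i.succ 0 * (M.F *ᵥ v t) l := by
    simp [tildeF, Matrix.mulVec, dotProduct, Finset.mul_sum, mul_assoc]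
  rw [auxOutput, tildeC, ← Matrix.mulVec_mulVec, Pi.add_apply, h1, h2, H_mulVec_apply,
    Fin.sum_univ_succ]
  simp only [virtualOutput, nodeOutput, Fin.sum_univ_succ, Fin.cons_succ, Fin.cons_zero,
    mul_sub, Finset.sum_sub_distrib, add_mul, Finset.sum_mul, Pi.neg_apply]
  ring

lemma isPlantTrajectory_iff (P : PlantMatrices N n m p q) (x : ℝ → Fin N × Fin n → ℝ)
    (u : ℝ → Fin N × Fin m → ℝ) (v : ℝ → Fin q → ℝ) :
    M.IsPlantTrajectory P x u v ↔ M.IsAuxTrajectory P x u v := by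
  have hE : ∀ t i j, (tildeE P *ᵥ v t) (i, j) = (P.E i *ᵥ v t) j := fun t i j => rfl
  constructor
  · intro h
    refine ⟨continuousOn_pi.2 fun ⟨i, j⟩ => continuousOn_pi.1 (h i).1 j, fun t ht => ?_⟩
    refine hasDerivWithinAt_pi.2 fun ⟨i, j⟩ => ?_
    have := hasDerivWithinAt_pi.1 ((h i).2 t ht) j
    simp only [Pi.add_apply, stackDiag_mulVec_apply, hE]
    exact this
  · intro h i
    refine ⟨continuousOn_pi.2 fun j => continuousOn_pi.1 h.1 (i, j), fun t ht => ?_⟩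
    refine hasDerivWithinAt_pi.2 fun j => ?_
    have := hasDerivWithinAt_pi.1 (h.2 t ht) (i, j)
    simp only [Pi.add_apply, stackDiag_mulVec_apply, hE] at this
    exact this

lemma isPlantClosedLoop_iff {E : Type} [NormedAddCommGroup E] (law : ControlLaw N n m p E)
    (P : PlantMatrices N n m p q) (x : ℝ → Fin N × Fin n → ℝ) (c : ℝ → E)
    (v : ℝ → Fin q → ℝ) :
    M.IsPlantClosedLoop law P x c v ↔ M.IsAuxClosedLoop law P x c v := by
  simp only [IsPlantClosedLoop, IsAuxClosedLoop, isPlantTrajectory_iff, virtualOutput_eq_auxOutput]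

/-- Since `e_v = (H ⊗ I) e` and `H` is invertible, the two regulation problems are equivalent. -/
lemma SolvesAuxRobustRegulation.cooperative {E : Type} [NormedAddCommGroup E]
    {M : LeaderFollowerNetwork N n m p q} {law : ControlLaw N n m p E}
    (h : M.SolvesAuxRobustRegulation law) (hT : HasDirectedSpanningTree M.graph 0) :
    M.SolvesCooperativeRobustRegulation law := by
  obtain ⟨hst, W, hW, hW0, hreg⟩ := h
  simp only [SolvesCooperativeRobustRegulation, isPlantClosedLoop_iff]
  refine ⟨hst, W, hW, hW0, fun w hw x c v hcl i => tendsto_pi_nhds.2 fun l => ?_⟩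
  have h1 := hreg w hw x c v hcl
  rw [← virtualOutput_eq_auxOutput] at h1
  have h2 : ∀ t, M.regulatedOutput (M.nominal + w) x v i t l =
      (M.H⁻¹ *ᵥ fun j => M.virtualOutput (M.nominal + w) x v t (j, l)) i := by
    intro t
    simp only [virtualOutput_apply]
    rw [Matrix.mulVec_mulVec, Matrix.nonsing_inv_mul _ (M.isUnit_det_H hT), Matrix.one_mulVec]
  simp only [h2]
  have h3 : Continuous fun e : Fin N × Fin p → ℝ => (M.H⁻¹ *ᵥ fun j => e (j, l)) i := by
    simp only [Matrix.mulVec, dotProduct]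
    fun_prop
  have h4 := (h3.tendsto 0).comp h1
  simpa [Matrix.mulVec, dotProduct, Function.comp_def] using h4

end LeaderFollowerNetwork

/-! ### The closed loop as a delay equation -/

section ContinuousFamily

variable {ι E W : Type*} [Fintype ι] [NormedAddCommGroup E] [NormedSpace ℝ E]
  [FiniteDimensional ℝ E] [TopologicalSpace W] {q : ℕ}

/-- The combination of robustness and the regulator equation, for a delay equation that depends
continuously on a parameter: for parameters near that of an exponentially stable equation, the
regulator equation is solvable and its solutions give the asymptotics of all forced states. -/
theorem ExponentiallyStable.eventually_exists_regulator_solution {r : ℝ} (hr : 0 ≤ r) {h : ι → ℝ}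
    (hh : ∀ i, 0 ≤ h i ∧ h i ≤ r) {A : W → ι → E →ₗ[ℝ] E} {w₀ : W}
    (hA : ∀ i X, Continuous fun w => A w i X)
    (hst : ExponentiallyStable r
      {X | IsDelaySolution r h (fun i => (A w₀ i).toContinuousLinearMap) X})
    {S : Matrix (Fin q) (Fin q) ℝ} (hS : EigenvaluesOnImaginaryAxis S)
    (B : W → ι → (Fin q → ℝ) →ₗ[ℝ] E) :
    ∀ᶠ w in 𝓝 w₀, ∃ Φ : (Fin q → ℝ) →ₗ[ℝ] E,
      (∀ v, Φ (S *ᵥ v) =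
        ∑ i, (A w i (Φ (exoFlow S (-h i) v)) + B w i (exoFlow S (-h i) v))) ∧
      ∀ (X : ℝ → E) (v : ℝ → Fin q → ℝ),
        (∀ t, 0 ≤ t → HasDerivWithinAt v (S *ᵥ v t) (Ici 0) t) →
        (∀ t, 0 ≤ t → HasDerivWithinAt X
          (∑ i, (A w i (X (t - h i)) + B w i (v (t - h i)))) (Ici 0) t) →
        Tendsto (fun t => X t - Φ (v t)) atTop (𝓝 0) := by
  have hc : Continuous fun w i => (A w i).toContinuousLinearMap :=
    continuous_pi fun i => continuous_clm_apply.2 fun X => hA i X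
  filter_upwards [(hc.tendsto w₀).eventually (hst.eventually_tendsto_zero hr hh)] with w hw
  obtain ⟨Φ, hΦ⟩ := exists_regulator_solution hw hS (B w)
  exact ⟨Φ, hΦ, fun X v hv hX => tendsto_sub_regulator_solution hr hh hw hΦ hv hX⟩

end ContinuousFamily

lemma HasDerivWithinAt.prod_fst {E F : Type*} [NormedAddCommGroup E] [NormedSpace ℝ E]
    [NormedAddCommGroup F] [NormedSpace ℝ F] {X : ℝ → E × F} {X' : E × F} {s : Set ℝ} {t : ℝ}
    (h : HasDerivWithinAt X X' s t) : HasDerivWithinAt (fun t => (X t).1) X'.1 s t :=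
  (ContinuousLinearMap.fst ℝ E F).hasFDerivAt.comp_hasDerivWithinAt t h

lemma HasDerivWithinAt.prod_snd {E F : Type*} [NormedAddCommGroup E] [NormedSpace ℝ E]
    [NormedAddCommGroup F] [NormedSpace ℝ F] {X : ℝ → E × F} {X' : E × F} {s : Set ℝ} {t : ℝ}
    (h : HasDerivWithinAt X X' s t) : HasDerivWithinAt (fun t => (X t).2) X'.2 s t :=
  (ContinuousLinearMap.snd ℝ E F).hasFDerivAt.comp_hasDerivWithinAt t h

lemma ExponentiallyStable.mono {E : Type*} [NormedAddCommGroup E] {r : ℝ} {s t : Set (ℝ → E)}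
    (ht : ExponentiallyStable r t) (hst : s ⊆ t) : ExponentiallyStable r s := by
  obtain ⟨κ, α, hα, h⟩ := ht
  exact ⟨κ, α, hα, fun X hX => h X (hst hX)⟩

namespace LeaderFollowerNetwork

variable {N n m p q d r : ℕ} (M : LeaderFollowerNetwork N n m p q) {Ec : Type}
  [NormedAddCommGroup Ec] [NormedSpace ℝ Ec]

/-- The four delays of the closed loop. -/
def loopDelay : Fin 4 → ℝ := ![0, M.τcom, M.τcon, M.τ]

lemma τ_nonneg : 0 ≤ M.τ := add_nonneg M.τcom_nonneg M.τcon_nonneg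

lemma loopDelay_mem (i : Fin 4) : 0 ≤ M.loopDelay i ∧ M.loopDelay i ≤ M.τ := by
  have h1 := M.τcom_nonneg
  have h2 := M.τcon_nonneg
  fin_cases i <;> simp [loopDelay, τ] <;> (try constructor) <;> linarith

/-- A linear controller with state `c`: `u(t) = U₁ x(t - τcom) + U₂ c(t)` and
`c'(t) = A₁ c(t) + A₂ e_v(t - τcom) + A₃ c(t - τ)`.  It covers the dynamic state feedback as well as
the dynamic output feedback. -/
def linearLaw (U₁ : (Fin N × Fin n → ℝ) →ₗ[ℝ] (Fin N × Fin m → ℝ))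
    (U₂ : Ec →ₗ[ℝ] (Fin N × Fin m → ℝ)) (A₁ : Ec →ₗ[ℝ] Ec)
    (A₂ : (Fin N × Fin p → ℝ) →ₗ[ℝ] Ec) (A₃ : Ec →ₗ[ℝ] Ec) : ControlLaw N n m p Ec :=
  fun x ev c u => (∀ t, -M.τcon ≤ t → u t = U₁ (x (t - M.τcom)) + U₂ (c t)) ∧
    ContinuousOn c (Ici (-M.τ)) ∧
    ∀ t, 0 ≤ t → HasDerivWithinAt c
      (A₁ (c t) + A₂ (ev (t - M.τcom)) + A₃ (c (t - M.τ))) (Ici 0) t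

/-- The coefficients of the closed loop under `linearLaw`, one for each delay in `loopDelay`. -/
def loopCoeff (U₁ : (Fin N × Fin n → ℝ) →ₗ[ℝ] (Fin N × Fin m → ℝ))
    (U₂ : Ec →ₗ[ℝ] (Fin N × Fin m → ℝ)) (A₁ : Ec →ₗ[ℝ] Ec)
    (A₂ : (Fin N × Fin p → ℝ) →ₗ[ℝ] Ec) (A₃ : Ec →ₗ[ℝ] Ec) (P : PlantMatrices N n m p q) :
    Fin 4 → ((Fin N × Fin n → ℝ) × Ec) →ₗ[ℝ] ((Fin N × Fin n → ℝ) × Ec) :=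
  ![(stackDiag P.A).mulVecLin.prodMap A₁,
    LinearMap.inr ℝ _ _ ∘ₗ A₂ ∘ₗ (M.tildeC P).mulVecLin ∘ₗ LinearMap.fst ℝ _ _,
    LinearMap.inl ℝ _ _ ∘ₗ (stackDiag P.B).mulVecLin ∘ₗ U₂ ∘ₗ LinearMap.snd ℝ _ _,
    ((stackDiag P.B).mulVecLin ∘ₗ U₁).prodMap A₃]

/-- The coefficients with which the exosystem state enters the closed loop under `linearLaw`. -/
def loopForcing (A₂ : (Fin N × Fin p → ℝ) →ₗ[ℝ] Ec) (P : PlantMatrices N n m p q) :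
    Fin 4 → (Fin q → ℝ) →ₗ[ℝ] ((Fin N × Fin n → ℝ) × Ec) :=
  ![LinearMap.inl ℝ _ _ ∘ₗ (tildeE P).mulVecLin, LinearMap.inr ℝ _ _ ∘ₗ A₂ ∘ₗ M.tildeF.mulVecLin,
    0, 0]

section

variable {U₁ : (Fin N × Fin n → ℝ) →ₗ[ℝ] (Fin N × Fin m → ℝ)}
  {U₂ : Ec →ₗ[ℝ] (Fin N × Fin m → ℝ)} {A₁ : Ec →ₗ[ℝ] Ec}
  {A₂ : (Fin N × Fin p → ℝ) →ₗ[ℝ] Ec} {A₃ : Ec →ₗ[ℝ] Ec}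

lemma sum_loopCoeff (P : PlantMatrices N n m p q) (X : ℝ → (Fin N × Fin n → ℝ) × Ec)
    (V : ℝ → Fin q → ℝ) :
    ∑ i, (M.loopCoeff U₁ U₂ A₁ A₂ A₃ P i (X (M.loopDelay i)) +
        M.loopForcing A₂ P i (V (M.loopDelay i))) =
      (stackDiag P.A *ᵥ (X 0).1 +
          stackDiag P.B *ᵥ (U₁ (X M.τ).1 + U₂ (X M.τcon).2) + tildeE P *ᵥ V 0,
        A₁ (X 0).2 + A₂ (M.tildeC P *ᵥ (X M.τcom).1 + M.tildeF *ᵥ V M.τcom) +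
          A₃ (X M.τ).2) := by
  simp only [Fin.sum_univ_four, loopCoeff, loopForcing, loopDelay]
  ext1
  · simp [Matrix.mulVec_add]; abel
  · simp

lemma continuous_loopCoeff [FiniteDimensional ℝ Ec] (i : Fin 4)
    (X : (Fin N × Fin n → ℝ) × Ec) :
    Continuous fun P => M.loopCoeff U₁ U₂ A₁ A₂ A₃ P i X := by
  have hA : Continuous fun P : PlantMatrices N n m p q => stackDiag P.A :=
    continuous_fst.matrix_blockDiagonal.matrix_submatrix _ _
  have hB : Continuous fun P : PlantMatrices N n m p q => stackDiag P.B :=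
    continuous_snd.fst.matrix_blockDiagonal.matrix_submatrix _ _
  have hC : Continuous fun P : PlantMatrices N n m p q => M.tildeC P :=
    continuous_const.matrix_mul
      (continuous_snd.snd.snd.matrix_blockDiagonal.matrix_submatrix _ _)
  have hA₂ : Continuous A₂ := A₂.continuous_of_finiteDimensional
  fin_cases i
  · exact (hA.matrix_mulVec continuous_const).prodMk continuous_const
  · exact continuous_const.prodMk (hA₂.comp (hC.matrix_mulVec continuous_const))
  · exact (hB.matrix_mulVec continuous_const).prodMk continuous_const
  · exact (hB.matrix_mulVec continuous_const).prodMk continuous_const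

lemma IsAuxClosedLoop.hasDerivWithinAt {M : LeaderFollowerNetwork N n m p q}
    {P : PlantMatrices N n m p q} {x : ℝ → Fin N × Fin n → ℝ} {c : ℝ → Ec} {v : ℝ → Fin q → ℝ}
    (h : M.IsAuxClosedLoop (M.linearLaw U₁ U₂ A₁ A₂ A₃) P x c v) {t : ℝ} (ht : 0 ≤ t) :
    HasDerivWithinAt (fun t => (x t, c t))
      (∑ i, (M.loopCoeff U₁ U₂ A₁ A₂ A₃ P i (x (t - M.loopDelay i), c (t - M.loopDelay i)) +
        M.loopForcing A₂ P i (v (t - M.loopDelay i)))) (Ici 0) t := by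
  obtain ⟨u, -, hx, hu, -, hc⟩ := h
  rw [M.sum_loopCoeff P (fun s => (x (t - s), c (t - s))) (fun s => v (t - s))]
  refine (((hx.2 t ht).prodMk (hc t ht))).congr_deriv ?_
  rw [hu _ (by linarith), show t - M.τcon - M.τcom = t - M.τ by rw [τ]; ring]
  simp [auxOutput]

lemma isAuxClosedLoop_of_isDelaySolution [FiniteDimensional ℝ Ec] {P : PlantMatrices N n m p q}
    {X : ℝ → (Fin N × Fin n → ℝ) × Ec}
    (hX : IsDelaySolution M.τ M.loopDelay
      (fun i => (M.loopCoeff U₁ U₂ A₁ A₂ A₃ P i).toContinuousLinearMap) X) :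
    M.IsAuxClosedLoop (M.linearLaw U₁ U₂ A₁ A₂ A₃) P (fun t => (X t).1) (fun t => (X t).2)
      (fun _ => 0) := by
  have hd : ∀ t, 0 ≤ t → HasDerivWithinAt X
      (stackDiag P.A *ᵥ (X t).1 +
          stackDiag P.B *ᵥ (U₁ (X (t - M.τ)).1 + U₂ (X (t - M.τcon)).2),
        A₁ (X t).2 + A₂ (M.tildeC P *ᵥ (X (t - M.τcom)).1) + A₃ (X (t - M.τ)).2) (Ici 0) t := by
    intro t ht
    refine (hX.2 t ht).congr_deriv ?_
    have := M.sum_loopCoeff (U₁ := U₁) (U₂ := U₂) (A₁ := A₁) (A₂ := A₂) (A₃ := A₃) P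
      (fun s => X (t - s)) (fun _ => 0)
    simpa using this
  refine ⟨fun t => U₁ (X (t - M.τcom)).1 + U₂ (X t).2, ⟨continuousOn_const, fun t _ => ?_⟩,
    ⟨hX.1.fst, fun t ht => ?_⟩, fun t _ => rfl, hX.1.snd, fun t ht => ?_⟩
  · simpa using hasDerivWithinAt_const t (Ici (0 : ℝ)) (0 : Fin q → ℝ)
  · have h1 := (hd t ht).prod_fst
    rw [show t - M.τ = t - M.τcon - M.τcom by rw [τ]; ring] at h1
    simpa using h1
  · simpa [auxOutput] using (hd t ht).prod_snd

/-- A stabilizing linear controller that contains the internal model, as the component `π c` of its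
state, regulates the output robustly. -/
theorem solvesAuxRobustRegulation_linearLaw [FiniteDimensional ℝ Ec]
    (hS : EigenvaluesOnImaginaryAxis M.S)
    {G₁ : Matrix (Fin p × Fin d) (Fin p × Fin d) ℝ} {G₂ : Matrix (Fin p × Fin d) (Fin p) ℝ}
    (hG : IsMinimalInternalModel M.S G₁ G₂) (π : Ec →ₗ[ℝ] (Fin N × Fin p × Fin d → ℝ))
    (hπ₁ : ∀ c, π (A₁ c) = ((1 : Matrix (Fin N) (Fin N) ℝ) ⊗ₖ G₁) *ᵥ π c)
    (hπ₂ : ∀ y, π (A₂ y) = ((1 : Matrix (Fin N) (Fin N) ℝ) ⊗ₖ G₂) *ᵥ y)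
    (hπ₃ : ∀ c, π (A₃ c) = 0)
    (hst : ExponentiallyStable M.τ {X : ℝ → (Fin N × Fin n → ℝ) × Ec | ∃ x c,
      (∀ t, X t = (x t, c t)) ∧
        M.IsAuxClosedLoop (M.linearLaw U₁ U₂ A₁ A₂ A₃) M.nominal x c (fun _ => 0)}) :
    M.SolvesAuxRobustRegulation (M.linearLaw U₁ U₂ A₁ A₂ A₃) := by
  refine ⟨hst, ?_⟩
  have hst' := hst.mono (s := {X | IsDelaySolution M.τ M.loopDelay
      (fun i => (M.loopCoeff U₁ U₂ A₁ A₂ A₃ M.nominal i).toContinuousLinearMap) X})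
    fun X hX => ⟨_, _, fun _ => rfl, M.isAuxClosedLoop_of_isDelaySolution hX⟩
  have hev := hst'.eventually_exists_regulator_solution M.τ_nonneg M.loopDelay_mem
    M.continuous_loopCoeff hS (M.loopForcing A₂)
  have hadd : Tendsto (fun w => M.nominal + w) (𝓝 0) (𝓝 M.nominal) := by
    have : Continuous fun w => M.nominal + w := by fun_prop
    simpa using this.tendsto 0
  obtain ⟨W, hW, hWo, hW0⟩ := eventually_nhds_iff.1 (hadd.eventually hev)
  refine ⟨W, hWo, hW0, fun w hw x c v hcl => ?_⟩
  obtain ⟨Φ, hΦ, hlim⟩ := hW w hw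
  set P := M.nominal + w with hP
  have hv : M.IsExosystemTrajectory v := by obtain ⟨u, hv, -⟩ := hcl; exact hv
  have hlim' := hlim _ v hv.2 fun t ht => hcl.hasDerivWithinAt ht
  -- the steady-state output `(C̃ Φ + F̃) v` vanishes by the internal model property
  let Y : (Fin q → ℝ) →ₗ[ℝ] (Fin N × Fin p → ℝ) :=
    (M.tildeC P).mulVecLin ∘ₗ LinearMap.fst ℝ _ _ ∘ₗ Φ + M.tildeF.mulVecLin
  have hY0 : Y ∘ₗ (exoFlow M.S (-M.τcom) : (Fin q → ℝ) →ₗ[ℝ] (Fin q → ℝ)) = 0 := by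
    refine hG.eq_zero (π ∘ₗ LinearMap.snd ℝ _ _ ∘ₗ Φ) _ fun v => ?_
    have h1 := hΦ v
    rw [M.sum_loopCoeff P (fun s => Φ (exoFlow M.S (-s) v)) (fun s => exoFlow M.S (-s) v)] at h1
    simp only [neg_zero, exoFlow_zero_apply] at h1
    simp only [LinearMap.comp_apply, LinearMap.snd_apply, h1, map_add, hπ₁, hπ₃, add_zero]
    rw [← map_add, ← map_add, hπ₂]
    rfl
  have hY : ∀ v, Y v = 0 := fun v => by
    obtain ⟨v', rfl⟩ := exoFlow_surjective M.S (-M.τcom) v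
    exact LinearMap.congr_fun hY0 v'
  have hout : ∀ t, M.auxOutput P x v t = M.tildeC P *ᵥ ((x t, c t) - Φ (v t)).1 := by
    intro t
    have h1 : M.tildeC P *ᵥ (Φ (v t)).1 + M.tildeF *ᵥ v t = 0 := hY (v t)
    rw [Prod.fst_sub, Matrix.mulVec_sub, auxOutput, eq_sub_iff_add_eq, add_assoc,
      add_comm (M.tildeF *ᵥ v t), h1, add_zero]
  have hcont : Continuous fun X : (Fin N × Fin n → ℝ) × Ec => M.tildeC P *ᵥ X.1 :=
    continuous_const.matrix_mulVec continuous_fst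
  have h2 := (hcont.tendsto 0).comp hlim'
  simp only [Prod.fst_zero, Matrix.mulVec_zero] at h2
  exact h2.congr fun t => (hout t).symm

end

lemma dynamicStateLaw_eq_linearLaw (G₁ : Matrix (Fin p × Fin d) (Fin p × Fin d) ℝ)
    (G₂ : Matrix (Fin p × Fin d) (Fin p) ℝ) (Kx : Matrix (Fin N × Fin m) (Fin N × Fin n) ℝ)
    (Kz : Matrix (Fin N × Fin m) (Fin N × Fin p × Fin d) ℝ) :
    M.dynamicStateLaw G₁ G₂ Kx Kz = M.linearLaw Kx.mulVecLin Kz.mulVecLin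
      ((1 : Matrix (Fin N) (Fin N) ℝ) ⊗ₖ G₁).mulVecLin
      ((1 : Matrix (Fin N) (Fin N) ℝ) ⊗ₖ G₂).mulVecLin 0 := by
  funext x ev z u
  simp only [dynamicStateLaw, linearLaw, IsInternalModelTrajectory, StaticStateFeedback,
    Matrix.mulVecLin_apply, LinearMap.zero_apply, add_zero]
  exact propext and_comm

lemma dynamicOutputLaw_eq_linearLaw (G₁ : Matrix (Fin p × Fin d) (Fin p × Fin d) ℝ)
    (G₂ : Matrix (Fin p × Fin d) (Fin p) ℝ)
    (K₁ : Matrix (Fin N × Fin m) (Fin N × Fin p × Fin d) ℝ)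
    (K₂ : Matrix (Fin N × Fin m) (Fin N × Fin r) ℝ)
    (S₁ : Matrix (Fin N × Fin r) (Fin N × Fin r) ℝ)
    (S₂ : Matrix (Fin N × Fin r) (Fin N × Fin p) ℝ)
    (S₃ : Matrix (Fin N × Fin r) ((Fin N × Fin p × Fin d) ⊕ (Fin N × Fin r)) ℝ) :
    M.dynamicOutputLaw G₁ G₂ K₁ K₂ S₁ S₂ S₃ = M.linearLaw 0 (K₁.mulVecLin.coprod K₂.mulVecLin)
      (((1 : Matrix (Fin N) (Fin N) ℝ) ⊗ₖ G₁).mulVecLin.prodMap S₁.mulVecLin)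
      (((1 : Matrix (Fin N) (Fin N) ℝ) ⊗ₖ G₂).mulVecLin.prod S₂.mulVecLin)
      (LinearMap.inr ℝ _ _ ∘ₗ S₃.mulVecLin ∘ₗ
        (LinearEquiv.sumArrowLequivProdArrow _ _ ℝ ℝ).symm.toLinearMap) := by
  have hsum : ∀ c : (Fin N × Fin p × Fin d → ℝ) × (Fin N × Fin r → ℝ),
      (LinearEquiv.sumArrowLequivProdArrow _ _ ℝ ℝ).symm c = Sum.elim c.1 c.2 := fun _ => rfl
  funext x ev c u
  simp only [dynamicOutputLaw, linearLaw, IsInternalModelTrajectory, DynamicOutputFeedback]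
  refine propext ⟨?_, ?_⟩
  · rintro ⟨⟨hz, hz'⟩, hu, hξ, hξ'⟩
    refine ⟨fun t ht => by simpa using hu t ht, hz.prodMk hξ, fun t ht => ?_⟩
    refine ((hz' t ht).prodMk (hξ' t ht)).congr_deriv ?_
    ext1 <;> simp [hsum]
  · rintro ⟨hu, hc, hc'⟩
    refine ⟨⟨hc.fst, fun t ht => ?_⟩, fun t ht => by simpa using hu t ht, hc.snd, fun t ht => ?_⟩
    · simpa using (hc' t ht).prod_fst
    · simpa [hsum] using (hc' t ht).prod_snd

end LeaderFollowerNetwork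

theorem mainTheorem3 {N n m p q d r : ℕ} (M : LeaderFollowerNetwork N n m p q)
    (hS : EigenvaluesOnImaginaryAxis M.S)
    (G₁ : Matrix (Fin p × Fin d) (Fin p × Fin d) ℝ) (G₂ : Matrix (Fin p × Fin d) (Fin p) ℝ)
    (hG : IsMinimalInternalModel M.S G₁ G₂) :
    (∀ (Kx : Matrix (Fin N × Fin m) (Fin N × Fin n) ℝ)
        (Kz : Matrix (Fin N × Fin m) (Fin N × Fin p × Fin d) ℝ),
      M.StaticStabilizesNominalAugmented G₁ G₂ Kx Kz →
        M.SolvesAuxRobustRegulation (M.dynamicStateLaw G₁ G₂ Kx Kz) ∧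
        (HasDirectedSpanningTree M.graph 0 →
          M.SolvesCooperativeRobustRegulation (M.dynamicStateLaw G₁ G₂ Kx Kz))) ∧
    (∀ (K₁ : Matrix (Fin N × Fin m) (Fin N × Fin p × Fin d) ℝ)
        (K₂ : Matrix (Fin N × Fin m) (Fin N × Fin r) ℝ)
        (S₁ : Matrix (Fin N × Fin r) (Fin N × Fin r) ℝ)
        (S₂ : Matrix (Fin N × Fin r) (Fin N × Fin p) ℝ)
        (S₃ : Matrix (Fin N × Fin r) ((Fin N × Fin p × Fin d) ⊕ (Fin N × Fin r)) ℝ),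
      M.DynamicStabilizesNominalAugmented G₁ G₂ K₁ K₂ S₁ S₂ S₃ →
        M.SolvesAuxRobustRegulation (M.dynamicOutputLaw G₁ G₂ K₁ K₂ S₁ S₂ S₃) ∧
        (HasDirectedSpanningTree M.graph 0 →
          M.SolvesCooperativeRobustRegulation (M.dynamicOutputLaw G₁ G₂ K₁ K₂ S₁ S₂ S₃))) := by
  constructor
  · intro Kx Kz hst
    have h : M.SolvesAuxRobustRegulation (M.dynamicStateLaw G₁ G₂ Kx Kz) := by
      rw [M.dynamicStateLaw_eq_linearLaw]
      refine M.solvesAuxRobustRegulation_linearLaw hS hG LinearMap.id (fun _ => rfl) (fun _ => rfl)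
        (fun _ => rfl) ?_
      rw [← M.dynamicStateLaw_eq_linearLaw]
      refine hst.mono ?_
      rintro X ⟨x, z, hX, u, hv, hx, hz, hu⟩
      exact ⟨x, z, u, hX, ⟨hv, hx, hz⟩, hu⟩
    exact ⟨h, h.cooperative⟩
  · intro K₁ K₂ S₁ S₂ S₃ hst
    have h : M.SolvesAuxRobustRegulation (M.dynamicOutputLaw G₁ G₂ K₁ K₂ S₁ S₂ S₃) := by
      rw [M.dynamicOutputLaw_eq_linearLaw]
      refine M.solvesAuxRobustRegulation_linearLaw hS hG (LinearMap.fst ℝ _ _) (fun _ => rfl)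
        (fun _ => rfl) (fun _ => rfl) ?_
      rw [← M.dynamicOutputLaw_eq_linearLaw]
      refine hst.mono ?_
      rintro X ⟨x, c, hX, u, hv, hx, hz, hξ⟩
      exact ⟨x, _, _, u, hX, ⟨hv, hx, hz⟩, hξ⟩
    exact ⟨h, h.cooperative⟩
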